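/- Let $\mathcal X,\mathcal Z$ be standard Borel spaces, let $\alpha\in(0,1)$, and let $(X_i,Y_i,\tilde Y_i,Z_i,M_i)$, $i=1,\dots,n+1$, be i.i.d., where $X_i\in\mathcal X$ are covariates, $Y_i\in\mathbb R$ is the clean label, $\tilde Y_i$ the observed label, $Z_i\in\mathcal Z$ the privileged information and $M_i\in\{0,1\}$ the corruption indicator ($M_i=1$: corrupted). The index $n+1$ is also denoted "test". Assume $(X^{\rm test},Y^{\rm test})\perp M^{\rm test}\mid Z^{\rm test}$. Let $I_1,I_2\subseteq\{1,\dots,n\}$ be disjoint. On the training data $T=(X_i,\tilde Y_i,Z_i,M_i)_{i\in I_1}$ a model $\hat f$ and a predictor $\hat g(x,z)\in\mathbb R$ are fitted; let $\mathcal S(x,y;\hat f)\in\mathbb R$ be a non-conformity score. For $i\in I_2$ put $$\bar Y_i=\begin{cases}Y_i,&M_i=0,\\ \hat g(X_i,Z_i)+e_i,&M_i=1,\end{cases}$$ where, conditionally on all the data, the $e_i$ are independent and $e_i$ is drawn from the true law of the error $E=Y^{\rm test}-\hat g(X^{\rm test},Z^{\rm test})$ given $Z^{\rm test}=Z_i$,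 for the trained $\hat g$ (i.e. given also $T$). Let $$Q^{\rm UI}=\inf\Bigl\{q\in[-\infty,\infty]:P\bigl([-\infty,q]\bigr)\ge 1-\alpha\Bigr\},\qquad P=\sum_{i\in I_2}\tfrac{1}{|I_2|+1}\delta_{\mathcal S(X_i,\bar Y_i;\hat f)}+\tfrac1{|I_2|+1}\delta_\infty,$$ and $C^{\rm UI}(x)=\{y\in\mathbb R:\mathcal S(x,y;\hat f)\le Q^{\rm UI}\}$. Assume that this set is almost surely an interval, $C^{\rm UI}(x)=\{y\in\mathbb R: a(x)\le y\le b(x)\}$ at $x=X^{\rm test}$, where the endpoints $a(x),b(x)\in[-\infty,\infty]$ are measurable functions of $\hat f$, $Q^{\rm UI}$ and $x$. Suppose that $Y^{\rm test}=g^*(X^{\rm test},Z^{\rm test})+\varepsilon$ with $\varepsilon\perp X^{\rm test}\mid Z^{\rm test}$, and that 1. there is a random variable $R^{\rm test}$ with $\hat g(X^{\rm test},Z^{\rm test})=g^*(X^{\rm test},Z^{\rm test})+R^{\rm test}$ and, for the trained models (i.e. conditionally on $Z^{\rm test}$ and $T$), $R^{\rm test}\perp\bigl(g^*(X^{\rm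 test},Z^{\rm test}),a(X^{\rm test}),b(X^{\rm test})\bigr)$; 2. $Y^{\rm test}$ has a conditional density $f_{x,z}$ given $X^{\rm test}=x$, $Z^{\rm test}=z$, and almost surely, for $x=X^{\rm test}$, $z=Z^{\rm test}$ and all $v>0$, $$f_{x,z}(b(x)+v)\le f_{x,z}(b(x)-v)\quad\text{and}\quad f_{x,z}(a(x)-v)\le f_{x,z}(a(x)+v)$$ (with no requirement at an endpoint that is infinite). Then $\mathbb P\bigl(Y^{\rm test}\in C^{\rm UI}(X^{\rm test})\bigr)\ge 1-\alpha$. -/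

import Mathlib

open MeasureTheory ProbabilityTheory
open scoped ENNReal

namespace UncertainImputation

/-- The data: `n` samples (indices `i.castSucc`, `i : Fin n`) and a test sample (index `Fin.last n`).
`X` are the covariates, `Y` the clean real label, `Yobs` the observed, possibly corrupted, label
(in an arbitrary space `𝓛`, which may contain a symbol for a missing label), `Z` the privileged
information and `M` the corruption indicator (`M = 0`: the label is clean, `M = 1`: corrupted). -/
structure Data (Ω 𝒳 𝓛 𝒵 : Type*) [MeasurableSpace Ω] [MeasurableSpace 𝒳] [MeasurableSpace 𝓛]
    [MeasurableSpace 𝒵] (n : ℕ) where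
  X : Fin (n + 1) → Ω → 𝒳
  Y : Fin (n + 1) → Ω → ℝ
  Yobs : Fin (n + 1) → Ω → 𝓛
  Z : Fin (n + 1) → Ω → 𝒵
  M : Fin (n + 1) → Ω → Fin 2
  measurable_X : ∀ i, Measurable (X i)
  measurable_Y : ∀ i, Measurable (Y i)
  measurable_Yobs : ∀ i, Measurable (Yobs i)
  measurable_Z : ∀ i, Measurable (Z i)
  measurable_M : ∀ i, Measurable (M i)

/-- The ingredients of the split procedure: disjoint index sets `I₁` (training) and `I₂`
(calibration), a learning algorithm `fit` producing a model `f̂` in some space `𝓕` of models, a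
learning algorithm `ghat` producing a predictor `ĝ(x, z)`, both applied to the observed training
data `(X, Yobs, Z, M)`, and a non-conformity score `score x y f̂`. -/
structure Procedure (𝒳 𝓛 𝒵 𝓕 : Type*) [MeasurableSpace 𝒳] [MeasurableSpace 𝓛]
    [MeasurableSpace 𝒵] [MeasurableSpace 𝓕] (n : ℕ) where
  I₁ : Finset (Fin n)
  I₂ : Finset (Fin n)
  disjoint : Disjoint I₁ I₂
  fit : (I₁ → 𝒳 × 𝓛 × 𝒵 × Fin 2) → 𝓕
  ghat : (I₁ → 𝒳 × 𝓛 × 𝒵 × Fin 2) → 𝒳 → 𝒵 → ℝ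
  score : 𝒳 → ℝ → 𝓕 → ℝ
  measurable_fit : Measurable fit
  measurable_ghat : Measurable
    (fun p : (I₁ → 𝒳 × 𝓛 × 𝒵 × Fin 2) × 𝒳 × 𝒵 => ghat p.1 p.2.1 p.2.2)
  measurable_score : Measurable (fun p : 𝒳 × ℝ × 𝓕 => score p.1 p.2.1 p.2.2)

/-- `Quantile(β; P) = inf {q : P((-∞, q]) ≥ β}` for a distribution `P` on the extended reals. -/
noncomputable def quantile (β : ℝ) (P : Measure EReal) : EReal :=
  sInf {q : EReal | ENNReal.ofReal β ≤ P (Set.Iic q)}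

/-- `∑ i, 1/(m+1) δ_{s i} + 1/(m+1) δ_∞`, where `m` is the number of scores. -/
noncomputable def augmentedEmpirical {ι : Type*} [Fintype ι] (s : ι → ℝ) : Measure EReal :=
  ∑ i, ((Fintype.card ι : ℝ≥0∞) + 1)⁻¹ • Measure.dirac ((s i : ℝ) : EReal)
    + ((Fintype.card ι : ℝ≥0∞) + 1)⁻¹ • Measure.dirac (⊤ : EReal)

/-- The density `f` on the line is peaked inside the interval `[a, b]`: for every `v > 0`,
`f (b + v) ≤ f (b - v)` and `f (a - v) ≤ f (a + v)`. An endpoint may be infinite, and nothing is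
then required at that endpoint. -/
def PeakedInside (f : ℝ → ℝ≥0∞) (a b : EReal) : Prop :=
  (∀ b' : ℝ, b = (b' : EReal) → ∀ v : ℝ, 0 < v → f (b' + v) ≤ f (b' - v)) ∧
  (∀ a' : ℝ, a = (a' : EReal) → ∀ v : ℝ, 0 < v → f (a' - v) ≤ f (a' + v))

section

variable {Ω 𝒳 𝓛 𝒵 𝓕 : Type*} [MeasurableSpace Ω] [MeasurableSpace 𝒳] [MeasurableSpace 𝓛]
  [MeasurableSpace 𝒵] [MeasurableSpace 𝓕] {n : ℕ}

/-- The full sample `(X_i, Y_i, Yobs_i, Z_i, M_i)`. -/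
def Data.sample (D : Data Ω 𝒳 𝓛 𝒵 n) (i : Fin (n + 1)) (ω : Ω) : 𝒳 × ℝ × 𝓛 × 𝒵 × Fin 2 :=
  (D.X i ω, D.Y i ω, D.Yobs i ω, D.Z i ω, D.M i ω)

/-- The test covariates. -/
def Data.Xtest (D : Data Ω 𝒳 𝓛 𝒵 n) : Ω → 𝒳 := D.X (Fin.last n)

/-- The clean test label. -/
def Data.Ytest (D : Data Ω 𝒳 𝓛 𝒵 n) : Ω → ℝ := D.Y (Fin.last n)

/-- The test privileged information. -/
def Data.Ztest (D : Data Ω 𝒳 𝓛 𝒵 n) : Ω → 𝒵 := D.Z (Fin.last n)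

/-- The test corruption indicator. -/
def Data.Mtest (D : Data Ω 𝒳 𝓛 𝒵 n) : Ω → Fin 2 := D.M (Fin.last n)

theorem Data.measurable_Ztest (D : Data Ω 𝒳 𝓛 𝒵 n) : Measurable D.Ztest :=
  D.measurable_Z _

/-- The observed training data `(X_i, Yobs_i, Z_i, M_i)`, `i ∈ I₁`. -/
def Procedure.train (P : Procedure 𝒳 𝓛 𝒵 𝓕 n) (D : Data Ω 𝒳 𝓛 𝒵 n) (ω : Ω) :
    P.I₁ → 𝒳 × 𝓛 × 𝒵 × Fin 2 :=
  fun i => (D.X i.1.castSucc ω, D.Yobs i.1.castSucc ω, D.Z i.1.castSucc ω, D.M i.1.castSucc ω)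

theorem Procedure.measurable_train (P : Procedure 𝒳 𝓛 𝒵 𝓕 n) (D : Data Ω 𝒳 𝓛 𝒵 n) :
    Measurable (P.train D) :=
  measurable_pi_lambda _ fun _ => (D.measurable_X _).prodMk ((D.measurable_Yobs _).prodMk
    ((D.measurable_Z _).prodMk (D.measurable_M _)))

/-- The pair (test privileged information, training data). -/
def Procedure.testZTrain (P : Procedure 𝒳 𝓛 𝒵 𝓕 n) (D : Data Ω 𝒳 𝓛 𝒵 n) (ω : Ω) :
    𝒵 × (P.I₁ → 𝒳 × 𝓛 × 𝒵 × Fin 2) :=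
  (D.Ztest ω, P.train D ω)

theorem Procedure.measurable_testZTrain (P : Procedure 𝒳 𝓛 𝒵 𝓕 n) (D : Data Ω 𝒳 𝓛 𝒵 n) :
    Measurable (P.testZTrain D) :=
  D.measurable_Ztest.prodMk (P.measurable_train D)

/-- The fitted model `f̂`. -/
def Procedure.model (P : Procedure 𝒳 𝓛 𝒵 𝓕 n) (D : Data Ω 𝒳 𝓛 𝒵 n) (ω : Ω) : 𝓕 :=
  P.fit (P.train D ω)

/-- The fitted predictor `ĝ(x, z)`. -/
def Procedure.predictor (P : Procedure 𝒳 𝓛 𝒵 𝓕 n) (D : Data Ω 𝒳 𝓛 𝒵 n) (ω : Ω) : 𝒳 → 𝒵 → ℝ :=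
  P.ghat (P.train D ω)

/-- The true error law: the conditional distribution of `E = Y - ĝ(X, Z)` for a fresh
sample given `Z`, for the trained `ĝ` (that is, given `Z` and the training data). -/
noncomputable def Procedure.errorLaw (P : Procedure 𝒳 𝓛 𝒵 𝓕 n) (D : Data Ω 𝒳 𝓛 𝒵 n)
    (μ : Measure Ω) [IsFiniteMeasure μ] : Kernel (𝒵 × (P.I₁ → 𝒳 × 𝓛 × 𝒵 × Fin 2)) ℝ :=
  condDistrib (fun ω => D.Ytest ω - P.predictor D ω (D.Xtest ω) (D.Ztest ω)) (P.testZTrain D) μ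

/-- `e` is a family of imputation errors drawn from the true law of `E | Z`: conditionally on all
the data, the `e i`, `i ∈ I₂`, are independent and `e i` has the law of `E` given `Z = Z_i`. -/
def Procedure.DrawnFromErrorLaw (P : Procedure 𝒳 𝓛 𝒵 𝓕 n) (D : Data Ω 𝒳 𝓛 𝒵 n)
    (e : P.I₂ → Ω → ℝ) (μ : Measure Ω) [IsFiniteMeasure μ] : Prop :=
  ∀ᵐ ω ∂μ, condDistrib (fun ω' (i : P.I₂) => e i ω') (fun ω' j => D.sample j ω') μ
      (fun j => D.sample j ω) =
    Measure.pi (fun i : P.I₂ => P.errorLaw D μ (D.Z i.1.castSucc ω, P.train D ω))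

/-- The imputed calibration label: `Y_i` if `M_i = 0`, and `ĝ(X_i, Z_i) + e_i` otherwise. -/
def Procedure.imputedLabel (P : Procedure 𝒳 𝓛 𝒵 𝓕 n) (D : Data Ω 𝒳 𝓛 𝒵 n)
    (e : P.I₂ → Ω → ℝ) (i : P.I₂) (ω : Ω) : ℝ :=
  if D.M i.1.castSucc ω = 0 then D.Y i.1.castSucc ω
  else P.predictor D ω (D.X i.1.castSucc ω) (D.Z i.1.castSucc ω) + e i ω

/-- The score of an imputed calibration sample. -/
def Procedure.imputedScore (P : Procedure 𝒳 𝓛 𝒵 𝓕 n) (D : Data Ω 𝒳 𝓛 𝒵 n)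
    (e : P.I₂ → Ω → ℝ) (i : P.I₂) (ω : Ω) : ℝ :=
  P.score (D.X i.1.castSucc ω) (P.imputedLabel D e i ω) (P.model D ω)

/-- The threshold `Q^UI`. -/
noncomputable def Procedure.threshold (P : Procedure 𝒳 𝓛 𝒵 𝓕 n) (D : Data Ω 𝒳 𝓛 𝒵 n)
    (e : P.I₂ → Ω → ℝ) (α : ℝ) (ω : Ω) : EReal :=
  quantile (1 - α) (augmentedEmpirical fun i => P.imputedScore D e i ω)

/-- The prediction set `C^UI(x) = {y : S(x, y; f̂) ≤ Q^UI}`. -/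
def Procedure.predictionSet (P : Procedure 𝒳 𝓛 𝒵 𝓕 n) (D : Data Ω 𝒳 𝓛 𝒵 n)
    (e : P.I₂ → Ω → ℝ) (α : ℝ) (ω : Ω) (x : 𝒳) : Set ℝ :=
  {y : ℝ | ((P.score x y (P.model D ω) : ℝ) : EReal) ≤ P.threshold D e α ω}

end

end UncertainImputation

open UncertainImputation

namespace UncertainImputation

/-! Suppose the test label were imputed as well: keep `Y` if `M = 0`, and otherwise take `ĝ(X, Z) +
e` with a fresh `e` from the error law at the test `Z`. Given the training data `T`, the calibration
pairs (sample, error) and the test pair are then i.i.d., so the rank argument of split conformal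
prediction covers this imputed label with probability at least `1 - α` (`conformal_coverage`,
`Procedure.lintegral_joint`, `Procedure.imputed_coverage`).

It remains to see that the true label is covered at least as often (`lintegral_imputed_le`). For `M
= 0` the two labels coincide. For `M = 1`, write `E = ε - R`. The error law given `(Z, T)` is that
of `ε' - R'` with `ε'` and `R'` independent (`condDistrib_error_ae_eq`), so the imputed label is `g*
+ ε' + (R - R')`, where `R'` is a conditionally independent copy of `R`. The shift `R - R'` is thus
symmetric, and independent of `g*` and of the endpoints. Peakedness says that shifting the label by
`d` and by `-d` captures, on average, no more mass than not shifting
(`PeakedInside.measure_shift_add_le`), and averaging over the symmetric shift concludes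
(`lintegral_sub_le_of_symm`).

Nothing is assumed about `R` jointly with `M`. Since `(X, Y) ⊥ M | Z`, the indicator of corruption
can be replaced by its conditional mean given `Z` before `R` is integrated out. -/

/-! ### Conditional laws and independence as integral identities. -/

theorem lintegral_condDistrib {Ω γ β : Type*} [MeasurableSpace Ω] [MeasurableSpace γ]
    [MeasurableSpace β] [StandardBorelSpace β] [Nonempty β] {μ : Measure Ω} [IsFiniteMeasure μ]
    {k : Ω → γ} {f : Ω → β} (hk : Measurable k) (hf : Measurable f) {h : γ × β → ℝ≥0∞}
    (hh : Measurable h) :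
    ∫⁻ ω, h (k ω, f ω) ∂μ = ∫⁻ ω, ∫⁻ y, h (k ω, y) ∂condDistrib f k μ (k ω) ∂μ := by
  rw [← lintegral_map (f := h) (g := fun ω => (k ω, f ω)) hh (hk.prodMk hf),
    ← compProd_map_condDistrib hf.aemeasurable, Measure.lintegral_compProd hh,
    lintegral_map hh.lintegral_kernel_prod_right' hk]

/-- Under conditional independence, the conditional law of `f` given `(k, g)` depends on `k` alone.
All conditional independence hypotheses enter the proof in this form. -/
theorem lintegral_of_condIndepFun {Ω γ β β' : Type*} [MeasurableSpace Ω] [StandardBorelSpace Ω]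
    [MeasurableSpace γ]
    [MeasurableSpace β] [StandardBorelSpace β] [Nonempty β]
    [MeasurableSpace β'] [StandardBorelSpace β'] [Nonempty β']
    {μ : Measure Ω} [IsFiniteMeasure μ]
    {k : Ω → γ} {f : Ω → β} {g : Ω → β'} (hk : Measurable k) (hf : Measurable f)
    (hg : Measurable g) (hind : g ⟂ᵢ[k, hk; μ] f)
    {h : γ × β' × β → ℝ≥0∞} (hh : Measurable h) :
    ∫⁻ ω, h (k ω, g ω, f ω) ∂μ =
      ∫⁻ ω, ∫⁻ y, h (k ω, g ω, y) ∂condDistrib f k μ (k ω) ∂μ := by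
  have hkg : Measurable fun ω => (k ω, g ω) := hk.prodMk hg
  have hh' : Measurable fun p : (γ × β') × β => h (p.1.1, p.1.2, p.2) :=
    hh.comp (by fun_prop)
  have key := lintegral_condDistrib (μ := μ) hkg hf hh'
  rw [key]
  have hae := ae_of_ae_map hkg.aemeasurable
    ((condIndepFun_iff_condDistrib_prod_ae_eq_prodMkRight hf hg hk).1 hind)
  refine lintegral_congr_ae ?_
  filter_upwards [hae] with ω hω
  rw [hω]
  rfl

theorem lintegral_of_indepFun {Ω β β' : Type*} [MeasurableSpace Ω]
    [MeasurableSpace β] [MeasurableSpace β'] {μ : Measure Ω} [IsFiniteMeasure μ]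
    {f : Ω → β} {g : Ω → β'} (hf : Measurable f) (hg : Measurable g) (hind : f ⟂ᵢ[μ] g)
    {h : β × β' → ℝ≥0∞} (hh : Measurable h) :
    ∫⁻ ω, h (f ω, g ω) ∂μ = ∫⁻ ω', ∫⁻ ω, h (f ω, g ω') ∂μ ∂μ := by
  rw [← lintegral_map (f := h) (g := fun ω => (f ω, g ω)) hh (hf.prodMk hg),
    (indepFun_iff_map_prod_eq_prod_map_map hf.aemeasurable hg.aemeasurable).1 hind,
    lintegral_prod_symm' _ hh, lintegral_map hh.lintegral_prod_left' hg]
  refine lintegral_congr fun ω' => ?_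
  rw [lintegral_map (f := fun x => h (x, g ω')) (hh.comp (by fun_prop)) hf]

/-- A disintegration of `f` given `(k, g)` by a kernel depending on `k` only remains valid when an
independent variable `u` is added. -/
theorem lintegral_disintegration_of_indepFun {Ω γ β β' 𝒰 : Type*} [MeasurableSpace Ω]
    [MeasurableSpace γ] [MeasurableSpace β] [MeasurableSpace β'] [MeasurableSpace 𝒰]
    {μ : Measure Ω} [IsFiniteMeasure μ] {k : Ω → γ} {f : Ω → β} {g : Ω → β'} {u : Ω → 𝒰}
    (hk : Measurable k) (hf : Measurable f) (hg : Measurable g) (hu : Measurable u)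
    (hind : (fun ω => (k ω, g ω, f ω)) ⟂ᵢ[μ] u) (η : Kernel γ β) [IsSFiniteKernel η]
    (hη : ∀ h : γ × β' × β → ℝ≥0∞, Measurable h →
      ∫⁻ ω, h (k ω, g ω, f ω) ∂μ = ∫⁻ ω, ∫⁻ y, h (k ω, g ω, y) ∂η (k ω) ∂μ)
    {h : γ × β' × β × 𝒰 → ℝ≥0∞} (hh : Measurable h) :
    ∫⁻ ω, h (k ω, g ω, f ω, u ω) ∂μ =
      ∫⁻ ω, ∫⁻ y, h (k ω, g ω, y, u ω) ∂η (k ω) ∂μ := by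
  have hind' : (fun ω => (k ω, g ω)) ⟂ᵢ[μ] u :=
    hind.comp (φ := fun p : γ × β' × β => (p.1, p.2.1)) (ψ := id) (by fun_prop) measurable_id
  -- On both sides independence freezes `u` at `u ω'`; for a frozen value the claim is `hη`.
  have e1 := lintegral_of_indepFun (hk.prodMk (hg.prodMk hf)) hu hind
    (h := fun p => h (p.1.1, p.1.2.1, p.1.2.2, p.2)) (hh.comp (by fun_prop))
  have hm : Measurable fun p : (γ × β') × 𝒰 => ∫⁻ y, h (p.1.1, p.1.2, y, p.2) ∂η p.1.1 := by
    have : Measurable fun q : ((γ × β') × 𝒰) × β => h (q.1.1.1, q.1.1.2, q.2, q.1.2) :=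
      hh.comp (by fun_prop)
    exact this.lintegral_kernel_prod_right'
      (κ := η.comap (fun p : (γ × β') × 𝒰 => p.1.1) (by fun_prop))
  have e2 := lintegral_of_indepFun (hk.prodMk hg) hu hind' hm
  simp only at e1 e2
  rw [e1, e2]
  exact lintegral_congr fun ω' =>
    hη (fun q => h (q.1, q.2.1, q.2.2, u ω')) (hh.comp (by fun_prop))

/-! ### Finite products of kernels. -/

theorem measurable_measure_pi {ι α β : Type*} [Fintype ι] [MeasurableSpace α] [MeasurableSpace β]
    (κ : ι → Kernel α β) [∀ i, IsMarkovKernel (κ i)] :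
    Measurable fun x => Measure.pi fun i => κ i x := by
  refine Measurable.measure_of_isPiSystem_of_isProbabilityMeasure
    (S := Set.univ.pi '' Set.univ.pi fun _ : ι => {s : Set β | MeasurableSet s})
    generateFrom_pi.symm isPiSystem_pi ?_
  rintro _ ⟨s, hs, rfl⟩
  simp only [Measure.pi_pi]
  exact Finset.measurable_fun_prod _ fun i _ => Kernel.measurable_coe _ (hs i trivial)

/-- The product of the kernels `κ i`. -/
noncomputable def piKernel {ι α β : Type*} [Fintype ι] [MeasurableSpace α] [MeasurableSpace β]
    (κ : ι → Kernel α β) [∀ i, IsMarkovKernel (κ i)] : Kernel α (ι → β) where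
  toFun x := Measure.pi fun i => κ i x
  measurable' := measurable_measure_pi κ

instance {ι α β : Type*} [Fintype ι] [MeasurableSpace α] [MeasurableSpace β]
    (κ : ι → Kernel α β) [∀ i, IsMarkovKernel (κ i)] : IsMarkovKernel (piKernel κ) :=
  ⟨fun x => inferInstanceAs (IsProbabilityMeasure (Measure.pi fun i => κ i x))⟩

theorem lintegral_pi_prod_eq {ι α : Type*} [Fintype ι] [MeasurableSpace α] (π : Measure α)
    [IsProbabilityMeasure π] {g : ι → α → ℝ≥0∞} (hg : ∀ i, Measurable (g i)) :
    ∫⁻ c, ∏ i, g i (c i) ∂Measure.pi (fun _ : ι => π) = ∏ i, ∫⁻ x, g i x ∂π := by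
  have hX : iIndepFun (fun i (c : ι → α) => g i (c i)) (Measure.pi fun _ : ι => π) :=
    iIndepFun_pi (fun i => (hg i).aemeasurable)
  rw [lintegral_prod_eq_prod_lintegral_of_indepFun Finset.univ _ hX fun i =>
    (hg i).comp (measurable_pi_apply i)]
  refine Finset.prod_congr rfl fun i _ => ?_
  exact (measurePreserving_eval (fun _ : ι => π) i).lintegral_comp (hg i)

/-- Drawing an i.i.d. family and then, independently, one further variable for each of its members
is drawing an i.i.d. family of pairs. -/
theorem lintegral_pi_pi {ι α β : Type*} [Fintype ι] [MeasurableSpace α] [MeasurableSpace β]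
    (π : Measure α) [IsProbabilityMeasure π] (κ : Kernel α β) [IsMarkovKernel κ]
    {H : (ι → α × β) → ℝ≥0∞} (hH : Measurable H) :
    ∫⁻ c, ∫⁻ e, H (fun i => (c i, e i)) ∂Measure.pi (fun i => κ (c i))
        ∂Measure.pi (fun _ : ι => π) =
      ∫⁻ p, H p ∂Measure.pi (fun _ : ι => π ⊗ₘ κ) := by
  let K : Kernel (ι → α) (ι → β) :=
    piKernel fun i => κ.comap (fun c : ι → α => c i) (measurable_pi_apply i)
  let φ : (ι → α) × (ι → β) → ι → α × β := fun p i => (p.1 i, p.2 i)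
  have hφ : Measurable φ := by unfold φ; fun_prop
  -- It suffices to compare the measures on boxes whose sides are rectangles `u i ×ˢ v i`; there
  -- both are the product over `i` of the integrals of `κ x (v i)` over `u i`.
  have key : Measure.pi (fun _ : ι => π ⊗ₘ κ) =
      ((Measure.pi fun _ : ι => π) ⊗ₘ K).map φ := by
    let C : Set (Set (α × β)) := Set.image2 (· ×ˢ ·) {s | MeasurableSet s} {t | MeasurableSet t}
    refine Measure.pi_eq_generateFrom (C := fun _ => C) (fun _ => generateFrom_prod)
      (fun _ => isPiSystem_prod) (fun _ => ⟨fun _ => Set.univ, fun _ =>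
        ⟨Set.univ, MeasurableSet.univ, Set.univ, MeasurableSet.univ, by simp⟩,
        fun _ => measure_lt_top _ _, Set.iUnion_const _⟩) ?_
    intro s hs
    choose u hu v hv huv using hs
    have hms : ∀ i, MeasurableSet (s i) := fun i => huv i ▸ (hu i).prod (hv i)
    rw [Measure.map_apply hφ (MeasurableSet.univ_pi hms)]
    have hpre : φ ⁻¹' Set.univ.pi s = Set.univ.pi u ×ˢ Set.univ.pi v := by
      ext p
      simp only [φ, Set.mem_preimage, Set.mem_univ_pi, Set.mem_prod, ← huv]
      exact forall_and
    rw [hpre, Measure.compProd_apply_prod (MeasurableSet.univ_pi hu) (MeasurableSet.univ_pi hv),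
      ← lintegral_indicator (MeasurableSet.univ_pi hu)]
    have : ∀ c : ι → α, (Set.univ.pi u).indicator (fun c => K c (Set.univ.pi v)) c =
        ∏ i, (u i).indicator (fun x => κ x (v i)) (c i) := by
      intro c
      by_cases hc : c ∈ Set.univ.pi u
      · rw [Set.indicator_of_mem hc]
        change Measure.pi (fun i => κ (c i)) _ = _
        rw [Measure.pi_pi]
        exact Finset.prod_congr rfl fun i _ =>
          (Set.indicator_of_mem (hc i trivial) fun x => κ x (v i)).symm
      · rw [Set.indicator_of_notMem hc]
        obtain ⟨i, hi⟩ : ∃ i, c i ∉ u i := by simpa using hc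
        exact (Finset.prod_eq_zero (Finset.mem_univ i) (Set.indicator_of_notMem hi _)).symm
    simp_rw [this]
    rw [lintegral_pi_prod_eq π fun i => (Kernel.measurable_coe κ (hv i)).indicator (hu i)]
    refine Finset.prod_congr rfl fun i _ => ?_
    rw [lintegral_indicator (hu i), ← huv i, Measure.compProd_apply_prod (hu i) (hv i)]
  rw [key, lintegral_map hH hφ, Measure.lintegral_compProd
    (f := fun a => H (φ a)) (hH.comp hφ)]
  rfl

/-! ### The conformal quantile: measurability and coverage. -/

theorem augmentedEmpirical_apply {ι : Type*} [Fintype ι] (s : ι → ℝ) (q : EReal) :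
    augmentedEmpirical s (Set.Iic q) = ((Fintype.card ι : ℝ≥0∞) + 1)⁻¹ *
      (∑ i, (Set.Iic q).indicator 1 ((s i : ℝ) : EReal) + (Set.Iic q).indicator 1 (⊤ : EReal)) := by
  simp only [augmentedEmpirical, Measure.add_apply, Measure.finsetSum_apply, Measure.smul_apply,
    smul_eq_mul, Measure.dirac_apply' _ measurableSet_Iic, mul_add, Finset.mul_sum]

/-- The distribution function is monotone, so rational levels suffice. This makes the quantile
measurable through a countable union, and the level found is finite, hence does not see the atom at
`∞`. -/
theorem quantile_lt_iff {β : ℝ} {P : Measure EReal} {c : EReal} :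
    quantile β P < c ↔ ∃ q : ℚ, ((q : ℝ) : EReal) < c ∧
      ENNReal.ofReal β ≤ P (Set.Iic ((q : ℝ) : EReal)) := by
  rw [quantile, sInf_lt_iff]
  constructor
  · rintro ⟨q, hq, hqc⟩
    obtain ⟨r, hr, hrc⟩ := EReal.lt_iff_exists_rat_btwn.1 hqc
    exact ⟨r, hrc, le_trans hq (measure_mono (Set.Iic_subset_Iic.2 hr.le))⟩
  · rintro ⟨q, hqc, hq⟩
    exact ⟨_, hq, hqc⟩

theorem measurable_quantile_augmentedEmpirical {ι : Type*} [Fintype ι] (β : ℝ) :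
    Measurable fun s : ι → ℝ => quantile β (augmentedEmpirical s) := by
  refine measurable_of_Iio fun c => ?_
  have : (fun s : ι → ℝ => quantile β (augmentedEmpirical s)) ⁻¹' Set.Iio c =
      ⋃ q : ℚ, {s : ι → ℝ | ((q : ℝ) : EReal) < c ∧
        ENNReal.ofReal β ≤ augmentedEmpirical s (Set.Iic ((q : ℝ) : EReal))} := by
    ext s
    simp [quantile_lt_iff]
  rw [this]
  refine MeasurableSet.iUnion fun q => (MeasurableSet.const _).inter ?_
  refine measurableSet_le (f := fun _ : ι → ℝ => ENNReal.ofReal β) measurable_const ?_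
  simp only [augmentedEmpirical_apply]
  refine ((Finset.measurable_fun_sum _ fun i _ => ?_).add_const _).const_mul _
  exact (measurable_one.indicator measurableSet_Iic).comp
    (measurable_coe_real_ereal.comp (measurable_pi_apply i))

/-- The number of indices whose score lies strictly below the `j`-th one. -/
noncomputable def rankBelow {κ : Type*} [Fintype κ] (s : κ → ℝ) (j : κ) : ℕ :=
  (Finset.univ.filter fun i => s i < s j).card

/-- Among the indices of rank at least `c`, take one with the smallest score. The indices strictly
below it number at least `c`, and by minimality they all have rank less than `c`. Ties cause no
trouble because ranks count strict inequalities. -/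
theorem card_rankBelow_lt {κ : Type*} [Fintype κ] (s : κ → ℝ) {c : ℝ}
    (hc : c ≤ Fintype.card κ) :
    c ≤ (Finset.univ.filter fun j => (rankBelow s j : ℝ) < c).card := by
  classical
  by_cases hB : (Finset.univ.filter fun j => c ≤ (rankBelow s j : ℝ)).Nonempty
  · obtain ⟨j, hj, hmin⟩ := Finset.exists_min_image _ s hB
    refine (Finset.mem_filter.1 hj).2.trans ?_
    rw [Nat.cast_le]
    refine Finset.card_le_card fun i hi => ?_
    rw [Finset.mem_filter] at hi ⊢
    refine ⟨Finset.mem_univ _, ?_⟩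
    by_contra! h
    exact absurd (hmin i (Finset.mem_filter.2 ⟨Finset.mem_univ _, h⟩)) (not_le.2 hi.2)
  · rw [Finset.not_nonempty_iff_eq_empty, Finset.filter_eq_empty_iff] at hB
    rw [Finset.filter_true_of_mem fun j hj => not_le.1 (hB hj)]
    simpa using hc

/-- The index `none` plays the test point. If its score exceeded the quantile, some finite level
below that score would carry mass at least `β`; the atom at `∞` does not contribute, and every
calibration score up to that level counts in the rank of `none`. -/
theorem le_quantile_of_rankBelow_lt {ι : Type*} [Fintype ι] {β : ℝ} (s : Option ι → ℝ)
    (h : (rankBelow s none : ℝ) < β * (Fintype.card ι + 1)) :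
    ((s none : ℝ) : EReal) ≤ quantile β (augmentedEmpirical fun i => s (some i)) := by
  by_contra! hlt
  obtain ⟨q, hq, hβ⟩ := quantile_lt_iff.1 hlt
  refine absurd h (not_lt.2 ?_)
  have hcard : (∑ i : ι, (Set.Iic ((q : ℝ) : EReal)).indicator (1 : EReal → ℝ≥0∞)
      ((s (some i) : ℝ) : EReal)) ≤ rankBelow s none := by
    have : (∑ i : ι, (Set.Iic ((q : ℝ) : EReal)).indicator (1 : EReal → ℝ≥0∞)
        ((s (some i) : ℝ) : EReal)) ≤
        ∑ i : ι, if s (some i) < s none then (1 : ℝ≥0∞) else 0 := by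
      refine Finset.sum_le_sum fun i _ => ?_
      by_cases hi : ((s (some i) : ℝ) : EReal) ≤ ((q : ℝ) : EReal)
      · have : s (some i) < s none := EReal.coe_lt_coe_iff.1 (hi.trans_lt hq)
        simp [this, hi]
      · rw [Set.indicator_of_notMem (by simpa using hi)]
        exact bot_le
    refine this.trans (le_of_eq ?_)
    rw [rankBelow, Finset.card_filter, Fintype.sum_option]
    push_cast
    simp
  have htop : (Set.Iic ((q : ℝ) : EReal)).indicator (1 : EReal → ℝ≥0∞) ⊤ = 0 :=
    Set.indicator_of_notMem (by simp) _
  rw [augmentedEmpirical_apply, htop, add_zero, ← ENNReal.div_eq_inv_mul,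
    ENNReal.le_div_iff_mul_le (by simp) (by simp)] at hβ
  have := hβ.trans hcard
  rw [show ((Fintype.card ι : ℝ≥0∞) + 1) = ENNReal.ofReal (Fintype.card ι + 1) by
      rw [ENNReal.ofReal_add (by positivity) zero_le_one]; simp,
    ← ENNReal.ofReal_mul' (by positivity), ← ENNReal.ofReal_natCast,
    ENNReal.ofReal_le_ofReal_iff (by positivity)] at this
  exact this

theorem rankBelow_comp_equiv {κ κ' : Type*} [Fintype κ] [Fintype κ'] (s : κ → ℝ) (σ : κ' ≃ κ)
    (j : κ') : rankBelow (fun i => s (σ i)) j = rankBelow s (σ j) := by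
  classical
  rw [rankBelow, rankBelow, ← Finset.card_map σ.toEmbedding]
  congr 1
  ext i
  simp only [Finset.mem_map_equiv, Finset.mem_filter, Finset.mem_univ, true_and,
    Equiv.apply_symm_apply]

theorem measurable_rankBelow {κ : Type*} [Fintype κ] (j : κ) :
    Measurable fun s : κ → ℝ => rankBelow s j := by
  simp only [rankBelow, Finset.card_filter]
  refine Finset.measurable_fun_sum _ fun i _ => Measurable.ite ?_ measurable_const measurable_const
  exact measurableSet_lt (measurable_pi_apply i) (measurable_pi_apply j)

/-- Marginal validity of the split conformal quantile for i.i.d. scores. -/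
theorem conformal_coverage {ι E : Type*} [Fintype ι] [MeasurableSpace E] (ν : Measure E)
    [IsProbabilityMeasure ν] {s : E → ℝ} (hs : Measurable s) {β : ℝ} (hβ : β ≤ 1) :
    ENNReal.ofReal β ≤ ∫⁻ p, ν {x | ((s x : ℝ) : EReal) ≤
      quantile β (augmentedEmpirical fun i => s (p i))} ∂Measure.pi (fun _ : ι => ν) := by
  classical
  let c : ℝ := β * (Fintype.card ι + 1)
  have hc : c ≤ Fintype.card (Option ι) := by
    rw [Fintype.card_option]; push_cast
    exact mul_le_of_le_one_left (by positivity) hβ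
  let μ : Measure (Option ι → E) := Measure.pi fun _ => ν
  let G : Option ι → Set (Option ι → E) := fun j => {p | (rankBelow (fun i => s (p i)) j : ℝ) < c}
  have hG : ∀ j, MeasurableSet (G j) := fun j => measurableSet_lt
    (measurable_from_nat.comp ((measurable_rankBelow j).comp (by fun_prop))) measurable_const
  -- Exchangeability: transposing `none` and `j` preserves the product measure and carries one event
  -- to the other.
  have hsym : ∀ j, μ (G j) = μ (G none) := by
    intro j
    have hσ := measurePreserving_piCongrLeft (fun _ : Option ι => ν) (Equiv.swap none j)
    rw [← hσ.measure_preimage (hG j).nullMeasurableSet]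
    congr 1
    ext p
    have hp : p = fun i => (MeasurableEquiv.piCongrLeft (fun _ : Option ι => E)
        (Equiv.swap none j)) p (Equiv.swap none j i) := by
      ext i
      exact (Equiv.piCongrLeft_apply_apply (fun _ : Option ι => E) (Equiv.swap none j) p i).symm
    simp only [G, Set.mem_preimage, Set.mem_ofPred_eq]
    conv_rhs => rw [hp]
    rw [rankBelow_comp_equiv (fun i => s ((MeasurableEquiv.piCongrLeft (fun _ : Option ι => E)
        (Equiv.swap none j)) p i)) (Equiv.swap none j) none, Equiv.swap_apply_left]
  -- For every outcome at least `c` of the events `G j` occur; by symmetry each then has at least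
  -- the fraction `β` of the total mass.
  have hsum : ENNReal.ofReal c ≤ ∑ j, μ (G j) := by
    calc ENNReal.ofReal c = ∫⁻ _, ENNReal.ofReal c ∂μ := by simp
      _ ≤ ∫⁻ p, ∑ j, (G j).indicator 1 p ∂μ := by
        refine lintegral_mono fun p => ?_
        have := card_rankBelow_lt (fun i => s (p i)) hc
        refine (ENNReal.ofReal_le_ofReal this).trans (le_of_eq ?_)
        rw [ENNReal.ofReal_natCast, Finset.card_filter]
        push_cast
        refine Finset.sum_congr rfl fun j _ => ?_
        simp [Set.indicator_apply, G]
      _ = ∑ j, μ (G j) := by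
        rw [lintegral_finsetSum _ fun j _ => measurable_one.indicator (hG j)]
        exact Finset.sum_congr rfl fun j _ => lintegral_indicator_one (hG j)
  have hnone : ENNReal.ofReal β ≤ μ (G none) := by
    simp only [hsym, Finset.sum_const, Finset.card_univ, nsmul_eq_mul, Fintype.card_option] at hsum
    rw [ENNReal.ofReal_mul' (by positivity), mul_comm,
      show ENNReal.ofReal ((Fintype.card ι : ℝ) + 1) = ((Fintype.card ι + 1 : ℕ) : ℝ≥0∞) by
        rw [← ENNReal.ofReal_natCast]; push_cast; rfl] at hsum
    exact (ENNReal.mul_le_mul_iff_right (by simp) (by simp)).1 hsum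
  refine hnone.trans ?_
  have hQ : MeasurableSet {q : (ι → E) × E | ((s q.2 : ℝ) : EReal) ≤
      quantile β (augmentedEmpirical fun i => s (q.1 i))} :=
    measurableSet_le (by fun_prop)
      ((measurable_quantile_augmentedEmpirical β).comp (by fun_prop))
  let e := (MeasurableEquiv.piOptionEquivProd fun _ : Option ι => E).symm
  calc μ (G none) = ((Measure.pi fun _ : ι => ν).prod ν) (e ⁻¹' G none) := by
        rw [← Measure.map_apply e.measurable (hG none)]
        exact congrArg (fun m : Measure (Option ι → E) => m (G none))
          (Measure.pi_map_piOptionEquivProd fun _ : Option ι => ν).symm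
    _ ≤ ((Measure.pi fun _ : ι => ν).prod ν) {q : (ι → E) × E | ((s q.2 : ℝ) : EReal) ≤
      quantile β (augmentedEmpirical fun i => s (q.1 i))} :=
        measure_mono fun q hq => le_quantile_of_rankBelow_lt (fun i => s (e q i)) hq
    _ = _ := Measure.prod_apply hQ

/-! ### Peaked densities and symmetric shifts. -/

theorem withDensity_Ioc_le_of_peaked {f : ℝ → ℝ≥0∞} {b d : ℝ}
    (h : ∀ v : ℝ, 0 < v → f (b + v) ≤ f (b - v)) :
    (volume.withDensity f) (Set.Ioc b (b + d)) ≤ (volume.withDensity f) (Set.Ioc (b - d) b) := by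
  rw [withDensity_apply _ measurableSet_Ioc, withDensity_apply _ measurableSet_Ioc,
    ← lintegral_indicator measurableSet_Ioc, ← lintegral_indicator measurableSet_Ioc,
    ← lintegral_add_left_eq_self _ b, ← lintegral_sub_left_eq_self
      ((Set.Ioc (b - d) b).indicator f) b]
  refine lintegral_mono_ae ?_
  -- Reflection about `b` swaps open and closed ends, so the half-open intervals correspond except
  -- at the single point `v = d`.
  filter_upwards [Measure.ae_ne volume d] with v hv
  by_cases hmem : b + v ∈ Set.Ioc b (b + d)
  · have h0 : 0 < v := by linarith [hmem.1]
    have hd : v < d := lt_of_le_of_ne (by linarith [hmem.2]) hv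
    rw [Set.indicator_of_mem hmem, Set.indicator_of_mem (Set.mem_Ioc.2
      ⟨by linarith, by linarith⟩)]
    exact h v h0
  · rw [Set.indicator_of_notMem hmem]
    exact bot_le

theorem withDensity_Ico_le_of_peaked {f : ℝ → ℝ≥0∞} {a d : ℝ}
    (h : ∀ v : ℝ, 0 < v → f (a - v) ≤ f (a + v)) :
    (volume.withDensity f) (Set.Ico (a - d) a) ≤ (volume.withDensity f) (Set.Ico a (a + d)) := by
  rw [withDensity_apply _ measurableSet_Ico, withDensity_apply _ measurableSet_Ico,
    ← lintegral_indicator measurableSet_Ico, ← lintegral_indicator measurableSet_Ico,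
    ← lintegral_add_left_eq_self ((Set.Ico a (a + d)).indicator f) a,
    ← lintegral_sub_left_eq_self _ a]
  refine lintegral_mono_ae ?_
  filter_upwards [Measure.ae_ne volume d] with v hv
  by_cases hmem : a - v ∈ Set.Ico (a - d) a
  · have h0 : 0 < v := by linarith [hmem.2]
    have hd : v < d := lt_of_le_of_ne (by linarith [hmem.1]) hv
    rw [Set.indicator_of_mem hmem, Set.indicator_of_mem (Set.mem_Ico.2
      ⟨by linarith, by linarith⟩)]
    exact h v h0
  · rw [Set.indicator_of_notMem hmem]
    exact bot_le

/-- The two shifts turn the half-line ending at `b` into those ending at `b - d` and `b + d`. The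
gain `(b, b + d]` is at most the loss `(b - d, b]`, its mirror image. -/
theorem withDensity_le_shift {f : ℝ → ℝ≥0∞} {b : EReal}
    (h : ∀ b' : ℝ, b = (b' : EReal) → ∀ v : ℝ, 0 < v → f (b' + v) ≤ f (b' - v))
    {d : ℝ} (hd : 0 ≤ d) :
    (volume.withDensity f) {y : ℝ | ((y + d : ℝ) : EReal) ≤ b} +
      (volume.withDensity f) {y : ℝ | ((y - d : ℝ) : EReal) ≤ b} ≤
      2 * (volume.withDensity f) {y : ℝ | (y : EReal) ≤ b} := by
  induction b with
  | bot => simp [-EReal.coe_add, -EReal.coe_sub]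
  | top => simp [two_mul]
  | coe b =>
    simp only [EReal.coe_le_coe_iff]
    have e1 : {y : ℝ | y + d ≤ b} = Set.Iic (b - d) := by ext y; simp [le_sub_iff_add_le]
    have e2 : {y : ℝ | y - d ≤ b} = Set.Iic (b + d) := by ext y; simp
    have e3 : {y : ℝ | y ≤ b} = Set.Iic b := rfl
    rw [e1, e2, e3, ← Set.Iic_union_Ioc_eq_Iic (show b ≤ b + d by linarith),
      measure_union (Set.Iic_disjoint_Ioc le_rfl) measurableSet_Ioc, two_mul, add_left_comm]
    refine add_le_add le_rfl ?_
    rw [← Set.Iic_union_Ioc_eq_Iic (show b - d ≤ b by linarith),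
      measure_union (Set.Iic_disjoint_Ioc le_rfl) measurableSet_Ioc]
    refine add_le_add le_rfl ?_
    exact withDensity_Ioc_le_of_peaked (h b rfl)

/-- The opposite inequality at the left end: the part below `a`, to be subtracted, gains mass on
average. -/
theorem withDensity_lt_shift {f : ℝ → ℝ≥0∞} {a : EReal}
    (h : ∀ a' : ℝ, a = (a' : EReal) → ∀ v : ℝ, 0 < v → f (a' - v) ≤ f (a' + v))
    {d : ℝ} (hd : 0 ≤ d) :
    2 * (volume.withDensity f) {y : ℝ | (y : EReal) < a} ≤
    (volume.withDensity f) {y : ℝ | ((y + d : ℝ) : EReal) < a} +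
      (volume.withDensity f) {y : ℝ | ((y - d : ℝ) : EReal) < a} := by
  induction a with
  | bot => simp
  | top => simp [two_mul, EReal.coe_lt_top, -EReal.coe_add, -EReal.coe_sub]
  | coe a =>
    have hdisj : ∀ x y : ℝ, Disjoint (Set.Iio x) (Set.Ico x y) := fun x y =>
      Set.disjoint_left.2 fun _ hy hy' => (not_lt.2 hy'.1) hy
    simp only [EReal.coe_lt_coe_iff]
    have e1 : {y : ℝ | y + d < a} = Set.Iio (a - d) := by ext y; simp [lt_sub_iff_add_lt]
    have e2 : {y : ℝ | y - d < a} = Set.Iio (a + d) := by ext y; simp [sub_lt_iff_lt_add]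
    have e3 : {y : ℝ | y < a} = Set.Iio a := rfl
    rw [e1, e2, e3, ← Set.Iio_union_Ico_eq_Iio (show a ≤ a + d by linarith),
      measure_union (hdisj _ _) measurableSet_Ico, two_mul, add_left_comm]
    refine add_le_add le_rfl ?_
    rw [← Set.Iio_union_Ico_eq_Iio (show a - d ≤ a by linarith),
      measure_union (hdisj _ _) measurableSet_Ico]
    refine add_le_add le_rfl ?_
    exact withDensity_Ico_le_of_peaked (h a rfl)

/-- Moving the interval by `d` to the left and by `d` to the right loses mass on average. -/
theorem PeakedInside.measure_shift_add_le {f : ℝ → ℝ≥0∞} {a b : EReal} (h : PeakedInside f a b)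
    [IsFiniteMeasure (volume.withDensity f)] (d : ℝ) :
    (volume.withDensity f) {y : ℝ | a ≤ ((y + d : ℝ) : EReal) ∧ ((y + d : ℝ) : EReal) ≤ b} +
      (volume.withDensity f) {y : ℝ | a ≤ ((y - d : ℝ) : EReal) ∧ ((y - d : ℝ) : EReal) ≤ b} ≤
      2 * (volume.withDensity f) {y : ℝ | a ≤ (y : EReal) ∧ (y : EReal) ≤ b} := by
  wlog hd : 0 ≤ d generalizing d
  · have := this (-d) (by linarith)
    simp only [sub_neg_eq_add, ← sub_eq_add_neg] at this
    rwa [add_comm]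
  rcases lt_or_ge b a with hab | hab
  · have : ∀ y : EReal, ¬ (a ≤ y ∧ y ≤ b) := fun y hy => (hy.1.trans hy.2).not_gt hab
    simp [this, -EReal.coe_add, -EReal.coe_sub]
  set Λ := volume.withDensity f
  -- An interval is a difference of two half-lines, which decouples the endpoints: `d` may exceed
  -- the length of the interval. This needs `a ≤ b`, hence the separate case above.
  have split : ∀ g : ℝ → ℝ, Measurable g → Λ {y | ((g y : ℝ) : EReal) ≤ b} =
      Λ {y | ((g y : ℝ) : EReal) < a} +
        Λ {y | a ≤ ((g y : ℝ) : EReal) ∧ ((g y : ℝ) : EReal) ≤ b} := by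
    intro g hg
    have hg' : Measurable fun y => ((g y : ℝ) : EReal) := measurable_coe_real_ereal.comp hg
    rw [← measure_union]
    · congr 1
      ext y
      refine ⟨fun hy => (lt_or_ge ((g y : ℝ) : EReal) a).imp id fun h => ⟨h, hy⟩, ?_⟩
      rintro (hy | hy)
      · exact (show ((g y : ℝ) : EReal) < a from hy).le.trans hab
      · exact hy.2
    · exact Set.disjoint_left.2 fun y hy hy' => (show ((g y : ℝ) : EReal) < a from hy).not_ge hy'.1
    · exact (measurableSet_le measurable_const hg').inter (measurableSet_le hg' measurable_const)
  have hb := withDensity_le_shift h.1 hd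
  have ha := withDensity_lt_shift h.2 hd
  rw [split (fun y => y + d) (by fun_prop), split (fun y => y - d) (by fun_prop),
    split (fun y => y) (by fun_prop), add_add_add_comm, mul_add] at hb
  have := hb.trans (add_le_add_left ha _)
  -- Finiteness of the measure allows the masses below `a` to be cancelled.
  exact (ENNReal.add_le_add_iff_left (ENNReal.add_ne_top.2
    ⟨measure_ne_top _ _, measure_ne_top _ _⟩)).1 this

/-- The difference of two i.i.d. variables is symmetric: exchanging `r` and `r'` and averaging the
two forms of the integral pairs `φ d` with `φ (-d)`. -/
theorem lintegral_sub_le_of_symm {ρ : Measure ℝ} [IsProbabilityMeasure ρ] {φ : ℝ → ℝ≥0∞}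
    (hφ : Measurable φ) (h : ∀ d, φ d + φ (-d) ≤ 2 * φ 0) :
    ∫⁻ r, ∫⁻ r', φ (r - r') ∂ρ ∂ρ ≤ φ 0 := by
  have hm : Measurable fun p : ℝ × ℝ => φ (p.1 - p.2) := by fun_prop
  have hm' : Measurable fun p : ℝ × ℝ => φ (p.2 - p.1) := by fun_prop
  have hswap : ∫⁻ r, ∫⁻ r', φ (r - r') ∂ρ ∂ρ = ∫⁻ r, ∫⁻ r', φ (r' - r) ∂ρ ∂ρ :=
    lintegral_lintegral_swap hm.aemeasurable
  have h2 : 2 * ∫⁻ r, ∫⁻ r', φ (r - r') ∂ρ ∂ρ ≤ 2 * φ 0 := by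
    calc 2 * ∫⁻ r, ∫⁻ r', φ (r - r') ∂ρ ∂ρ
        = ∫⁻ r, ∫⁻ r', φ (r - r') ∂ρ ∂ρ + ∫⁻ r, ∫⁻ r', φ (r' - r) ∂ρ ∂ρ := by
          rw [two_mul]; nth_rewrite 2 [hswap]; rfl
      _ = ∫⁻ r, ∫⁻ r', (φ (r - r') + φ (r' - r)) ∂ρ ∂ρ := by
          rw [← lintegral_add_left hm.lintegral_prod_right']
          exact lintegral_congr fun r =>
            (lintegral_add_left (hm.comp measurable_prodMk_left) _).symm
      _ ≤ ∫⁻ _, ∫⁻ _, 2 * φ 0 ∂ρ ∂ρ := by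
          gcongr with r r'
          simpa using h (r - r')
      _ = 2 * φ 0 := by simp
  exact (ENNReal.mul_le_mul_iff_right (by simp) (by simp)).1 h2

/-! ### Coverage of the imputed label against coverage of the true label. -/

section Comparison

variable {Ω 𝒳 𝒵 𝒯 𝒬 : Type*} [MeasurableSpace Ω] [MeasurableSpace 𝒳] [MeasurableSpace 𝒵]
  [MeasurableSpace 𝒯] [MeasurableSpace 𝒬] {μ : Measure Ω} [IsProbabilityMeasure μ]
  {X : Ω → 𝒳} {Y : Ω → ℝ} {Z : Ω → 𝒵} {M : Ω → Fin 2} {T : Ω → 𝒯} {Q : Ω → 𝒬}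
  {gstar : 𝒳 → 𝒵 → ℝ} {ghat : 𝒯 → 𝒳 → 𝒵 → ℝ}

/-- The prediction error is the noise minus the independent error of the regression function. -/
theorem condDistrib_error_ae_eq (hX : Measurable X) (hY : Measurable Y) (hZ : Measurable Z)
    (hT : Measurable T)
    (hg : Measurable fun p : 𝒳 × 𝒵 => gstar p.1 p.2)
    (hgh : Measurable fun p : 𝒯 × 𝒳 × 𝒵 => ghat p.1 p.2.1 p.2.2)
    (η : Kernel 𝒵 ℝ) [IsMarkovKernel η] (ρ : Kernel (𝒵 × 𝒯) ℝ) [IsMarkovKernel ρ]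
    (hη : ∀ h : 𝒵 × 𝒳 × ℝ × 𝒯 × 𝒬 → ℝ≥0∞, Measurable h →
      ∫⁻ ω, h (Z ω, X ω, Y ω - gstar (X ω) (Z ω), T ω, Q ω) ∂μ =
        ∫⁻ ω, ∫⁻ y, h (Z ω, X ω, y, T ω, Q ω) ∂η (Z ω) ∂μ)
    (hρ : ∀ h : (𝒵 × 𝒯) × ℝ → ℝ≥0∞, Measurable h →
      ∫⁻ ω, h ((Z ω, T ω), ghat (T ω) (X ω) (Z ω) - gstar (X ω) (Z ω)) ∂μ =
        ∫⁻ ω, ∫⁻ r, h ((Z ω, T ω), r) ∂ρ (Z ω, T ω) ∂μ) :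
    ∀ᵐ ω ∂μ, ∀ G : ℝ → ℝ≥0∞, Measurable G →
      ∫⁻ e, G e ∂condDistrib (fun ω => Y ω - ghat (T ω) (X ω) (Z ω)) (fun ω => (Z ω, T ω)) μ
        (Z ω, T ω) = ∫⁻ r, ∫⁻ y, G (y - r) ∂η (Z ω) ∂ρ (Z ω, T ω) := by
  let κ' : Kernel (𝒵 × 𝒯) ℝ :=
    ((η.comap Prod.fst measurable_fst) ×ₖ ρ).map fun p : ℝ × ℝ => p.1 - p.2
  have hsub : Measurable fun p : ℝ × ℝ => p.1 - p.2 := by fun_prop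
  have : IsMarkovKernel κ' := Kernel.IsMarkovKernel.map _ hsub
  have hκ' : ∀ w, ∀ G : ℝ → ℝ≥0∞, Measurable G →
      ∫⁻ e, G e ∂κ' w = ∫⁻ r, ∫⁻ y, G (y - r) ∂η w.1 ∂ρ w := by
    intro w G hG
    rw [Kernel.lintegral_map _ hsub _ hG, Kernel.prod_apply,
      lintegral_prod_symm' (fun a : ℝ × ℝ => G (a.1 - a.2)) (hG.comp hsub)]
    rfl
  have hgh' : Measurable fun ω => ghat (T ω) (X ω) (Z ω) :=
    hgh.comp (hT.prodMk (hX.prodMk hZ))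
  have hW : Measurable fun ω => (Z ω, T ω) := hZ.prodMk hT
  have hE : Measurable fun ω => Y ω - ghat (T ω) (X ω) (Z ω) := hY.sub hgh'
  -- By uniqueness of conditional distributions it is enough that `κ'` gives the right joint law.
  -- The noise is integrated out first, with `X` and `T` held fixed; then `ĝ - g*`, a function of
  -- `X`, `Z`, `T`, is integrated against `ρ`.
  have key : condDistrib (fun ω => Y ω - ghat (T ω) (X ω) (Z ω)) (fun ω => (Z ω, T ω)) μ
      =ᵐ[μ.map fun ω => (Z ω, T ω)] κ' := by
    refine condDistrib_ae_eq_of_measure_eq_compProd _ hE.aemeasurable ?_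
    refine Measure.ext_of_lintegral _ fun h hh => ?_
    rw [lintegral_map hh (hW.prodMk hE), Measure.lintegral_compProd hh,
      lintegral_map hh.lintegral_kernel_prod_right' hW]
    have e1 := hη (fun p => h ((p.1, p.2.2.2.1),
      p.2.2.1 - (ghat p.2.2.2.1 p.2.1 p.1 - gstar p.2.1 p.1))) (by
        refine hh.comp (Measurable.prodMk (by fun_prop) (Measurable.sub (by fun_prop)
          (Measurable.sub ?_ ?_)))
        · exact hgh.comp (g := fun p : 𝒯 × 𝒳 × 𝒵 => ghat p.1 p.2.1 p.2.2)
            (f := fun p : 𝒵 × 𝒳 × ℝ × 𝒯 × 𝒬 => (p.2.2.2.1, p.2.1, p.1)) (by fun_prop)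
        · exact hg.comp (g := fun p : 𝒳 × 𝒵 => gstar p.1 p.2)
            (f := fun p : 𝒵 × 𝒳 × ℝ × 𝒯 × 𝒬 => (p.2.1, p.1)) (by fun_prop))
    have e2 := hρ (fun p => ∫⁻ y, h (p.1, y - p.2) ∂η p.1.1) (by
      have : Measurable fun q : ((𝒵 × 𝒯) × ℝ) × ℝ => h (q.1.1, q.2 - q.1.2) :=
        hh.comp (by fun_prop)
      exact this.lintegral_kernel_prod_right'
        (κ := η.comap (fun p : (𝒵 × 𝒯) × ℝ => p.1.1) (by fun_prop)))
    simp only [sub_sub_sub_cancel_right] at e1 e2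
    rw [e1, e2]
    refine lintegral_congr fun ω => ?_
    exact (hκ' (Z ω, T ω) (fun e => h ((Z ω, T ω), e)) (hh.comp (by fun_prop))).symm
  filter_upwards [ae_of_ae_map hW.aemeasurable key] with ω hω G hG
  rw [hω, hκ' _ G hG]

/-- The label is the regression function plus the noise. -/
theorem condDistrib_label_ae_eq (hX : Measurable X) (hY : Measurable Y) (hZ : Measurable Z)
    (hg : Measurable fun p : 𝒳 × 𝒵 => gstar p.1 p.2) (η : Kernel 𝒵 ℝ) [IsMarkovKernel η]
    (hη : ∀ h : 𝒵 × 𝒳 × ℝ → ℝ≥0∞, Measurable h →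
      ∫⁻ ω, h (Z ω, X ω, Y ω - gstar (X ω) (Z ω)) ∂μ =
        ∫⁻ ω, ∫⁻ y, h (Z ω, X ω, y) ∂η (Z ω) ∂μ) :
    ∀ᵐ ω ∂μ, ∀ G : ℝ → ℝ≥0∞, Measurable G →
      ∫⁻ y, G y ∂condDistrib Y (fun ω => (X ω, Z ω)) μ (X ω, Z ω) =
        ∫⁻ y, G (gstar (X ω) (Z ω) + y) ∂η (Z ω) := by
  have hadd : Measurable fun p : ((𝒳 × 𝒵) × ℝ) => gstar p.1.1 p.1.2 + p.2 :=
    (hg.comp measurable_fst).add measurable_snd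
  let κ' : Kernel (𝒳 × 𝒵) ℝ :=
    (Kernel.id ×ₖ (η.comap Prod.snd measurable_snd)).map
      fun p : ((𝒳 × 𝒵) × ℝ) => gstar p.1.1 p.1.2 + p.2
  have : IsMarkovKernel κ' := Kernel.IsMarkovKernel.map _ hadd
  have hκ' : ∀ w, ∀ G : ℝ → ℝ≥0∞, Measurable G →
      ∫⁻ y, G y ∂κ' w = ∫⁻ y, G (gstar w.1 w.2 + y) ∂η w.2 := by
    intro w G hG
    rw [Kernel.lintegral_map _ hadd _ hG, Kernel.prod_apply, Kernel.id_apply,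
      lintegral_prod (fun a : (𝒳 × 𝒵) × ℝ => G (gstar a.1.1 a.1.2 + a.2))
        (hG.comp hadd).aemeasurable]
    exact lintegral_dirac' _ ((hG.comp hadd).lintegral_prod_right'
      (ν := η.comap Prod.snd measurable_snd w))
  have hXZ : Measurable fun ω => (X ω, Z ω) := hX.prodMk hZ
  have key : condDistrib Y (fun ω => (X ω, Z ω)) μ =ᵐ[μ.map fun ω => (X ω, Z ω)] κ' := by
    refine condDistrib_ae_eq_of_measure_eq_compProd _ hY.aemeasurable ?_
    refine Measure.ext_of_lintegral _ fun h hh => ?_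
    rw [lintegral_map hh (hXZ.prodMk hY), Measure.lintegral_compProd hh,
      lintegral_map hh.lintegral_kernel_prod_right' hXZ]
    have e1 := hη (fun p => h ((p.2.1, p.1), gstar p.2.1 p.1 + p.2.2)) (by
      refine hh.comp (Measurable.prodMk (by fun_prop) (Measurable.add ?_ (by fun_prop)))
      exact hg.comp (g := fun p : 𝒳 × 𝒵 => gstar p.1 p.2)
        (f := fun p : 𝒵 × 𝒳 × ℝ => (p.2.1, p.1)) (by fun_prop))
    simp only [add_sub_cancel] at e1
    rw [e1]
    refine lintegral_congr fun ω => ?_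
    exact (hκ' (X ω, Z ω) (fun y => h ((X ω, Z ω), y)) (hh.comp (by fun_prop))).symm
  filter_upwards [ae_of_ae_map hXZ.aemeasurable key] with ω hω G hG
  rw [hω, hκ' _ G hG]

/-- Replacing the label by an imputed one does not increase the coverage of corrupted samples. -/
theorem lintegral_imputed_le (hX : Measurable X) (hY : Measurable Y) (hZ : Measurable Z)
    (hT : Measurable T)
    (hg : Measurable fun p : 𝒳 × 𝒵 => gstar p.1 p.2)
    (hgh : Measurable fun p : 𝒯 × 𝒳 × 𝒵 => ghat p.1 p.2.1 p.2.2)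
    {c : 𝒯 → 𝒬 → 𝒳 → EReal × EReal}
    (hc : Measurable fun p : 𝒯 × 𝒬 × 𝒳 => c p.1 p.2.1 p.2.2)
    (η : Kernel 𝒵 ℝ) [IsMarkovKernel η] (ρ : Kernel (𝒵 × 𝒯) ℝ) [IsMarkovKernel ρ]
    (θ : Kernel 𝒵 (Fin 2)) [IsMarkovKernel θ]
    (hη : ∀ h : 𝒵 × 𝒳 × ℝ × 𝒯 × 𝒬 → ℝ≥0∞, Measurable h →
      ∫⁻ ω, h (Z ω, X ω, Y ω - gstar (X ω) (Z ω), T ω, Q ω) ∂μ =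
        ∫⁻ ω, ∫⁻ y, h (Z ω, X ω, y, T ω, Q ω) ∂η (Z ω) ∂μ)
    (hρ : ∀ h : (𝒵 × 𝒯) × (ℝ × EReal × EReal) × ℝ → ℝ≥0∞, Measurable h →
      ∫⁻ ω, h ((Z ω, T ω), (gstar (X ω) (Z ω), c (T ω) (Q ω) (X ω)),
        ghat (T ω) (X ω) (Z ω) - gstar (X ω) (Z ω)) ∂μ =
        ∫⁻ ω, ∫⁻ r, h ((Z ω, T ω), (gstar (X ω) (Z ω), c (T ω) (Q ω) (X ω)), r)
          ∂ρ (Z ω, T ω) ∂μ)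
    (hθ : ∀ h : 𝒵 × (𝒳 × ℝ) × Fin 2 × 𝒯 × 𝒬 → ℝ≥0∞, Measurable h →
      ∫⁻ ω, h (Z ω, (X ω, Y ω), M ω, T ω, Q ω) ∂μ =
        ∫⁻ ω, ∫⁻ m, h (Z ω, (X ω, Y ω), m, T ω, Q ω) ∂θ (Z ω) ∂μ)
    {J : (EReal × EReal) × ℝ → ℝ≥0∞} (hJ : Measurable J)
    (hpeak : ∀ᵐ ω ∂μ, ∀ d : ℝ,
      ∫⁻ y, J (c (T ω) (Q ω) (X ω), gstar (X ω) (Z ω) + y + d) ∂η (Z ω) +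
        ∫⁻ y, J (c (T ω) (Q ω) (X ω), gstar (X ω) (Z ω) + y - d) ∂η (Z ω) ≤
        2 * ∫⁻ y, J (c (T ω) (Q ω) (X ω), gstar (X ω) (Z ω) + y) ∂η (Z ω))
    {ψ : Fin 2 → ℝ≥0∞} :
    ∫⁻ ω, ψ (M ω) * ∫⁻ e, J (c (T ω) (Q ω) (X ω), ghat (T ω) (X ω) (Z ω) + e)
        ∂condDistrib (fun ω => Y ω - ghat (T ω) (X ω) (Z ω)) (fun ω => (Z ω, T ω)) μ
          (Z ω, T ω) ∂μ ≤
      ∫⁻ ω, ψ (M ω) * J (c (T ω) (Q ω) (X ω), Y ω) ∂μ := by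
  have hψ : Measurable ψ := measurable_of_finite ψ
  let m : 𝒵 → ℝ≥0∞ := fun z => ∫⁻ i, ψ i ∂θ z
  have hm : Measurable m := hψ.lintegral_kernel
  -- The weight `ψ (M)` becomes its conditional mean `m (Z)`. This must come before `hρ`, whose test
  -- functions do not involve `M`.
  have hθ' : ∀ h : (𝒵 × 𝒳 × ℝ × 𝒯 × 𝒬) → ℝ≥0∞, Measurable h →
      ∫⁻ ω, ψ (M ω) * h (Z ω, X ω, Y ω, T ω, Q ω) ∂μ =
        ∫⁻ ω, m (Z ω) * h (Z ω, X ω, Y ω, T ω, Q ω) ∂μ := by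
    intro h hh
    have := hθ (fun p => ψ p.2.2.1 * h (p.1, p.2.1.1, p.2.1.2, p.2.2.2)) (by fun_prop)
    simp only at this
    rw [this]
    exact lintegral_congr fun ω => lintegral_mul_const _ hψ
  set κ := condDistrib (fun ω => Y ω - ghat (T ω) (X ω) (Z ω)) (fun ω => (Z ω, T ω)) μ with hκdef
  have hκ := condDistrib_error_ae_eq (μ := μ) hX hY hZ hT hg hgh η ρ hη (fun h hh =>
    hρ (fun p => h (p.1, p.2.2)) (by fun_prop))
  have hc5 : Measurable fun p : 𝒵 × 𝒳 × ℝ × 𝒯 × 𝒬 => c p.2.2.2.1 p.2.2.2.2 p.2.1 :=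
    hc.comp (g := fun p : 𝒯 × 𝒬 × 𝒳 => c p.1 p.2.1 p.2.2)
      (f := fun p : 𝒵 × 𝒳 × ℝ × 𝒯 × 𝒬 => (p.2.2.2.1, p.2.2.2.2, p.2.1)) (by fun_prop)
  have hg5 : Measurable fun p : 𝒵 × 𝒳 × ℝ × 𝒯 × 𝒬 => gstar p.2.1 p.1 :=
    hg.comp (g := fun p : 𝒳 × 𝒵 => gstar p.1 p.2)
      (f := fun p : 𝒵 × 𝒳 × ℝ × 𝒯 × 𝒬 => (p.2.1, p.1)) (by fun_prop)
  have hgh5 : Measurable fun p : 𝒵 × 𝒳 × ℝ × 𝒯 × 𝒬 => ghat p.2.2.2.1 p.2.1 p.1 :=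
    hgh.comp (g := fun p : 𝒯 × 𝒳 × 𝒵 => ghat p.1 p.2.1 p.2.2)
      (f := fun p : 𝒵 × 𝒳 × ℝ × 𝒯 × 𝒬 => (p.2.2.2.1, p.2.1, p.1)) (by fun_prop)
  have l1 := hθ' (fun p => ∫⁻ e, J (c p.2.2.2.1 p.2.2.2.2 p.2.1, ghat p.2.2.2.1 p.2.1 p.1 + e)
      ∂κ (p.1, p.2.2.2.1)) (by
    have : Measurable fun q : (𝒵 × 𝒳 × ℝ × 𝒯 × 𝒬) × ℝ =>
        J (c q.1.2.2.2.1 q.1.2.2.2.2 q.1.2.1, ghat q.1.2.2.2.1 q.1.2.1 q.1.1 + q.2) :=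
      hJ.comp ((hc5.comp measurable_fst).prodMk ((hgh5.comp measurable_fst).add measurable_snd))
    exact this.lintegral_kernel_prod_right'
      (κ := κ.comap (fun p : 𝒵 × 𝒳 × ℝ × 𝒯 × 𝒬 => (p.1, p.2.2.2.1)) (by fun_prop)))
  have r1 := hθ' (fun p => J (c p.2.2.2.1 p.2.2.2.2 p.2.1, p.2.2.1)) (hJ.comp
    (hc5.prodMk (by fun_prop)))
  have r2 := hη (fun p => m p.1 * J (c p.2.2.2.1 p.2.2.2.2 p.2.1, gstar p.2.1 p.1 + p.2.2.1))
    ((hm.comp measurable_fst).mul (hJ.comp (hc5.prodMk (hg5.add (by fun_prop)))))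
  have l2 := hρ (fun p => m p.1.1 *
      ∫⁻ e, J (p.2.1.2, p.2.1.1 + p.2.2 + e) ∂κ p.1) (by
    refine (hm.comp (by fun_prop)).mul ?_
    have : Measurable fun q : ((𝒵 × 𝒯) × (ℝ × EReal × EReal) × ℝ) × ℝ =>
        J (q.1.2.1.2, q.1.2.1.1 + q.1.2.2 + q.2) :=
      hJ.comp (by fun_prop)
    exact this.lintegral_kernel_prod_right'
      (κ := κ.comap (fun p : (𝒵 × 𝒯) × (ℝ × EReal × EReal) × ℝ => p.1) (by fun_prop)))
  simp only [add_sub_cancel] at l1 l2 r1 r2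
  rw [l1, l2, r1, r2]
  refine lintegral_mono_ae ?_
  filter_upwards [hκ, hpeak] with ω hω hpω
  set A := gstar (X ω) (Z ω)
  set C := c (T ω) (Q ω) (X ω)
  have hJy : Measurable fun y => J (C, A + y) := hJ.comp (by fun_prop)
  rw [lintegral_const_mul _ hJy]
  let φ : ℝ → ℝ≥0∞ := fun d => ∫⁻ y, J (C, A + y + d) ∂η (Z ω)
  have hφ : Measurable φ :=
    Measurable.lintegral_prod_right' (f := fun p : ℝ × ℝ => J (C, A + p.2 + p.1))
      (hJ.comp (by fun_prop))
  -- With `e = y - r'`, the imputed label is `A + y` shifted by `r - r'`. The test function depends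
  -- on `ω`, which is why the exceptional null set in `hκ` is uniform in `G`.
  have hin : ∀ r, ∫⁻ e, J (C, A + r + e) ∂κ (Z ω, T ω) =
      ∫⁻ r', φ (r - r') ∂ρ (Z ω, T ω) := by
    intro r
    rw [hω (fun e => J (C, A + r + e)) (hJ.comp (by fun_prop))]
    refine lintegral_congr fun r' => lintegral_congr fun y => ?_
    congr 2
    ring
  simp_rw [hin]
  rw [lintegral_const_mul]
  · refine mul_le_mul_right ?_ _
    have := lintegral_sub_le_of_symm (ρ := ρ (Z ω, T ω)) hφ (fun d => by
      simpa [φ, sub_eq_add_neg] using hpω d)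
    simpa [φ] using this
  · exact Measurable.lintegral_prod_right' (f := fun p : ℝ × ℝ => φ (p.1 - p.2)) (by fun_prop)

end Comparison

/-! ### Joint law of training, calibration and test data. -/

section JointLaw

variable {Ω 𝒳 𝓛 𝒵 𝓕 : Type*} [MeasurableSpace Ω] [MeasurableSpace 𝒳] [MeasurableSpace 𝓛]
  [MeasurableSpace 𝒵] [MeasurableSpace 𝓕] {n : ℕ}

theorem Data.measurable_sample (D : Data Ω 𝒳 𝓛 𝒵 n) (i : Fin (n + 1)) :
    Measurable (D.sample i) :=
  (D.measurable_X i).prodMk ((D.measurable_Y i).prodMk ((D.measurable_Yobs i).prodMk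
    ((D.measurable_Z i).prodMk (D.measurable_M i))))

/-- The law of the imputation error of a sample `x`, for the training data `t`. -/
noncomputable def Procedure.sampleErrorLaw (P : Procedure 𝒳 𝓛 𝒵 𝓕 n) (D : Data Ω 𝒳 𝓛 𝒵 n)
    (μ : Measure Ω) [IsFiniteMeasure μ] (t : P.I₁ → 𝒳 × 𝓛 × 𝒵 × Fin 2) :
    Kernel (𝒳 × ℝ × 𝓛 × 𝒵 × Fin 2) ℝ :=
  (P.errorLaw D μ).comap (fun x => (x.2.2.2.1, t)) (by fun_prop)

instance (P : Procedure 𝒳 𝓛 𝒵 𝓕 n) (D : Data Ω 𝒳 𝓛 𝒵 n) (μ : Measure Ω) [IsFiniteMeasure μ] :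
    IsMarkovKernel (P.errorLaw D μ) := by
  rw [Procedure.errorLaw]; infer_instance

instance (P : Procedure 𝒳 𝓛 𝒵 𝓕 n) (D : Data Ω 𝒳 𝓛 𝒵 n) (μ : Measure Ω) [IsFiniteMeasure μ]
    (t : P.I₁ → 𝒳 × 𝓛 × 𝒵 × Fin 2) : IsMarkovKernel (P.sampleErrorLaw D μ t) := by
  rw [Procedure.sampleErrorLaw]; infer_instance

/-- The calibration samples together with their imputation errors. -/
def Procedure.calibration (P : Procedure 𝒳 𝓛 𝒵 𝓕 n) (D : Data Ω 𝒳 𝓛 𝒵 n) (e : P.I₂ → Ω → ℝ)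
    (ω : Ω) (i : P.I₂) : (𝒳 × ℝ × 𝓛 × 𝒵 × Fin 2) × ℝ :=
  (D.sample i.1.castSucc ω, e i ω)

theorem Procedure.measurable_calibration (P : Procedure 𝒳 𝓛 𝒵 𝓕 n) (D : Data Ω 𝒳 𝓛 𝒵 n)
    {e : P.I₂ → Ω → ℝ} (he : ∀ i, Measurable (e i)) : Measurable (P.calibration D e) :=
  measurable_pi_lambda _ fun i => (D.measurable_sample _).prodMk (he i)

variable {μ : Measure Ω} {D : Data Ω 𝒳 𝓛 𝒵 n}
  {P : Procedure 𝒳 𝓛 𝒵 𝓕 n} {e : P.I₂ → Ω → ℝ}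

theorem Procedure.indepFun_test_train_calibration (h_indep : iIndepFun D.sample μ) :
    D.sample (Fin.last n) ⟂ᵢ[μ]
      (fun ω => (P.train D ω, fun i : P.I₂ => D.sample i.1.castSucc ω)) := by
  have h := h_indep.indepFun_finset {Fin.last n} {Fin.last n}ᶜ disjoint_compl_right
    D.measurable_sample
  have hmem : ∀ i : Fin n, i.castSucc ∈ ({Fin.last n}ᶜ : Finset (Fin (n + 1))) := fun i => by
    simp
  exact h.comp
    (φ := fun x : ({Fin.last n} : Finset (Fin (n + 1))) → 𝒳 × ℝ × 𝓛 × 𝒵 × Fin 2 =>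
      x ⟨Fin.last n, Finset.mem_singleton_self _⟩)
    (ψ := fun x : ({Fin.last n}ᶜ : Finset (Fin (n + 1))) → 𝒳 × ℝ × 𝓛 × 𝒵 × Fin 2 =>
      ((fun i : P.I₁ => ((x ⟨i.1.castSucc, hmem i⟩).1, (x ⟨i.1.castSucc, hmem i⟩).2.2)),
        fun i : P.I₂ => x ⟨i.1.castSucc, hmem i⟩))
    (by fun_prop) (by fun_prop)

theorem Procedure.indepFun_train_calibration (h_indep : iIndepFun D.sample μ) :
    P.train D ⟂ᵢ[μ] (fun ω (i : P.I₂) => D.sample i.1.castSucc ω) := by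
  have h := h_indep.indepFun_finset (P.I₁.map Fin.castSuccEmb) (P.I₂.map Fin.castSuccEmb)
    ((Finset.disjoint_map _).2 P.disjoint) D.measurable_sample
  exact h.comp
    (φ := fun x : {j // j ∈ P.I₁.map Fin.castSuccEmb} → 𝒳 × ℝ × 𝓛 × 𝒵 × Fin 2 =>
      fun i : P.I₁ => ((x ⟨i.1.castSucc, Finset.mem_map_of_mem _ i.2⟩).1,
        (x ⟨i.1.castSucc, Finset.mem_map_of_mem _ i.2⟩).2.2))
    (ψ := fun x : {j // j ∈ P.I₂.map Fin.castSuccEmb} → 𝒳 × ℝ × 𝓛 × 𝒵 × Fin 2 =>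
      fun i : P.I₂ => x ⟨i.1.castSucc, Finset.mem_map_of_mem _ i.2⟩)
    (by fun_prop) (by fun_prop)

theorem Procedure.map_calibration_sample (h_indep : iIndepFun D.sample μ)
    (h_ident : ∀ i, IdentDistrib (D.sample i) (D.sample (Fin.last n)) μ μ) :
    μ.map (fun ω (i : P.I₂) => D.sample i.1.castSucc ω) =
      Measure.pi fun _ => μ.map (D.sample (Fin.last n)) := by
  have h := h_indep.precomp (g := fun i : P.I₂ => i.1.castSucc)
    ((Fin.castSucc_injective n).comp Subtype.val_injective)
  rw [h.map_fun_eq_pi_map fun i => (D.measurable_sample _).aemeasurable]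
  congr 1
  ext1 i
  exact (h_ident _).map_eq

/-- Given all the data, the errors are independent with laws depending only on the respective `Z_i`
and the training data. Integrating them out leaves a function of three independent blocks, and for
frozen training data the calibration pairs become i.i.d. by `lintegral_pi_pi`. -/
theorem Procedure.lintegral_joint [IsProbabilityMeasure μ] (h_indep : iIndepFun D.sample μ)
    (h_ident : ∀ i, IdentDistrib (D.sample i) (D.sample (Fin.last n)) μ μ)
    (he_meas : ∀ i, Measurable (e i)) (he : P.DrawnFromErrorLaw D e μ)
    {H : (P.I₁ → 𝒳 × 𝓛 × 𝒵 × Fin 2) × (𝒳 × ℝ × 𝓛 × 𝒵 × Fin 2) ×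
      (P.I₂ → (𝒳 × ℝ × 𝓛 × 𝒵 × Fin 2) × ℝ) → ℝ≥0∞} (hH : Measurable H) :
    ∫⁻ ω, H (P.train D ω, D.sample (Fin.last n) ω, P.calibration D e ω) ∂μ =
      ∫⁻ ω', ∫⁻ ω, ∫⁻ p, H (P.train D ω', D.sample (Fin.last n) ω, p)
        ∂Measure.pi (fun _ : P.I₂ =>
          μ.map (D.sample (Fin.last n)) ⊗ₘ P.sampleErrorLaw D μ (P.train D ω')) ∂μ ∂μ := by
  have hT := P.measurable_train D
  have hS := D.measurable_sample
  have hc : Measurable fun ω (i : P.I₂) => D.sample i.1.castSucc ω :=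
    measurable_pi_lambda _ fun i => hS _
  have hprob : IsProbabilityMeasure (μ.map (D.sample (Fin.last n))) :=
    Measure.isProbabilityMeasure_map (hS _).aemeasurable
  let F : (P.I₁ → 𝒳 × 𝓛 × 𝒵 × Fin 2) × (𝒳 × ℝ × 𝓛 × 𝒵 × Fin 2) ×
      (P.I₂ → 𝒳 × ℝ × 𝓛 × 𝒵 × Fin 2) → ℝ≥0∞ := fun q =>
    ∫⁻ y, H (q.1, q.2.1, fun i => (q.2.2 i, y i))
      ∂Measure.pi fun i => P.sampleErrorLaw D μ q.1 (q.2.2 i)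
  have hF : Measurable F := by
    let K : Kernel ((P.I₁ → 𝒳 × 𝓛 × 𝒵 × Fin 2) × (𝒳 × ℝ × 𝓛 × 𝒵 × Fin 2) ×
        (P.I₂ → 𝒳 × ℝ × 𝓛 × 𝒵 × Fin 2)) (P.I₂ → ℝ) :=
      piKernel fun i => (P.errorLaw D μ).comap (fun q => ((q.2.2 i).2.2.2.1, q.1)) (by fun_prop)
    exact Measurable.lintegral_kernel_prod_right' (κ := K)
      (f := fun q => H (q.1.1, q.1.2.1, fun i => (q.1.2.2 i, q.2 i))) (hH.comp (by fun_prop))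
  have step : ∫⁻ ω, H (P.train D ω, D.sample (Fin.last n) ω, P.calibration D e ω) ∂μ =
      ∫⁻ ω, F (P.train D ω, D.sample (Fin.last n) ω, fun i => D.sample i.1.castSucc ω) ∂μ := by
    have h := lintegral_condDistrib (μ := μ) (k := fun ω j => D.sample j ω)
      (f := fun ω (i : P.I₂) => e i ω) (measurable_pi_lambda _ hS) (measurable_pi_lambda _ he_meas)
      (h := fun q => H ((fun i : P.I₁ => ((q.1 i.1.castSucc).1, (q.1 i.1.castSucc).2.2)),
        q.1 (Fin.last n), fun i => (q.1 i.1.castSucc, q.2 i))) (hH.comp (by fun_prop))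
    refine h.trans (lintegral_congr_ae ?_)
    filter_upwards [he] with ω hω
    rw [hω]
    rfl
  rw [step]
  have e1 := lintegral_of_indepFun (hS _) (hT.prodMk hc)
    (P.indepFun_test_train_calibration h_indep) (h := fun q => F (q.2.1, q.1, q.2.2))
    (hF.comp (by fun_prop))
  simp only at e1
  rw [e1]
  have hG : Measurable fun q : (P.I₁ → 𝒳 × 𝓛 × 𝒵 × Fin 2) × (P.I₂ → 𝒳 × ℝ × 𝓛 × 𝒵 × Fin 2) =>
      ∫⁻ ω, F (q.1, D.sample (Fin.last n) ω, q.2) ∂μ :=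
    Measurable.lintegral_prod_right' (f := fun r : (_ × _) × Ω =>
      F (r.1.1, D.sample (Fin.last n) r.2, r.1.2))
      (hF.comp (measurable_fst.fst.prodMk (((hS _).comp measurable_snd).prodMk measurable_fst.snd)))
  have e2 := lintegral_of_indepFun hc hT (P.indepFun_train_calibration h_indep).symm
    (h := fun q => ∫⁻ ω, F (q.2, D.sample (Fin.last n) ω, q.1) ∂μ) (hG.comp measurable_swap)
  simp only at e2
  rw [e2]
  refine lintegral_congr fun ω' => ?_
  rw [lintegral_lintegral_swap]
  · refine lintegral_congr fun ω => ?_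
    rw [← lintegral_map (f := fun c => F (P.train D ω', D.sample (Fin.last n) ω, c))
      (hF.comp (by fun_prop)) hc, P.map_calibration_sample h_indep h_ident]
    exact lintegral_pi_pi (μ.map (D.sample (Fin.last n))) (P.sampleErrorLaw D μ (P.train D ω'))
      (H := fun p => H (P.train D ω', D.sample (Fin.last n) ω, p))
      (hH.comp (by fun_prop))
  · exact (hF.comp (g := F) (f := fun r : Ω × Ω =>
      (P.train D ω', D.sample (Fin.last n) r.2, fun i => D.sample i.1.castSucc r.1))
      (measurable_const.prodMk (((hS _).comp measurable_snd).prodMk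
        (hc.comp measurable_fst)))).aemeasurable

/-- Independence of the samples does not cover the errors `e`, on which the threshold depends. In
`Procedure.lintegral_joint`, however, the test sample is integrated separately, and products factor.
-/
theorem Procedure.indepFun_test [IsProbabilityMeasure μ] (h_indep : iIndepFun D.sample μ)
    (h_ident : ∀ i, IdentDistrib (D.sample i) (D.sample (Fin.last n)) μ μ)
    (he_meas : ∀ i, Measurable (e i)) (he : P.DrawnFromErrorLaw D e μ) :
    D.sample (Fin.last n) ⟂ᵢ[μ] fun ω => (P.train D ω, P.calibration D e ω) := by
  have hS := D.measurable_sample (Fin.last n)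
  have hTC := (P.measurable_train D).prodMk (P.measurable_calibration D he_meas)
  rw [indepFun_iff_measure_inter_preimage_eq_mul]
  intro A B hA hB
  let b : Ω → ℝ≥0∞ := fun ω' => ∫⁻ p, B.indicator 1 (P.train D ω', p)
    ∂Measure.pi (fun _ : P.I₂ =>
      μ.map (D.sample (Fin.last n)) ⊗ₘ P.sampleErrorLaw D μ (P.train D ω'))
  have key : ∀ A : Set (𝒳 × ℝ × 𝓛 × 𝒵 × Fin 2), MeasurableSet A →
      μ (D.sample (Fin.last n) ⁻¹' A ∩
        (fun ω => (P.train D ω, P.calibration D e ω)) ⁻¹' B) =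
      (μ (D.sample (Fin.last n) ⁻¹' A)) * ∫⁻ ω', b ω' ∂μ := by
    intro A hA
    have h := P.lintegral_joint h_indep h_ident he_meas he
      (H := fun q => A.indicator 1 q.2.1 * B.indicator 1 (q.1, q.2.2))
      (((measurable_one.indicator hA).comp (by fun_prop)).mul
        ((measurable_one.indicator hB).comp (by fun_prop)))
    have hl : ∫⁻ ω, A.indicator (1 : 𝒳 × ℝ × 𝓛 × 𝒵 × Fin 2 → ℝ≥0∞) (D.sample (Fin.last n) ω) *
        B.indicator 1 (P.train D ω, P.calibration D e ω) ∂μ =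
        μ (D.sample (Fin.last n) ⁻¹' A ∩
        (fun ω => (P.train D ω, P.calibration D e ω)) ⁻¹' B) := by
      rw [← lintegral_indicator_one ((hS hA).inter (hTC hB))]
      refine lintegral_congr fun ω => ?_
      rw [Set.inter_indicator_one]
      rfl
    have hA1 : ∫⁻ ω, A.indicator (1 : 𝒳 × ℝ × 𝓛 × 𝒵 × Fin 2 → ℝ≥0∞)
        (D.sample (Fin.last n) ω) ∂μ =
        μ (D.sample (Fin.last n) ⁻¹' A) := by
      rw [← lintegral_indicator_one (hS hA)]
      rfl
    have hAm : Measurable fun ω => A.indicator (1 : 𝒳 × ℝ × 𝓛 × 𝒵 × Fin 2 → ℝ≥0∞)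
        (D.sample (Fin.last n) ω) :=
      (measurable_one.indicator hA).comp hS
    rw [← hl, h, ← hA1]
    rw [← lintegral_const_mul' _ _ (by rw [hA1]; exact measure_ne_top _ _)]
    refine lintegral_congr fun ω' => ?_
    rw [← lintegral_mul_const _ hAm]
    refine lintegral_congr fun ω => ?_
    have hBm : Measurable fun p : P.I₂ → (𝒳 × ℝ × 𝓛 × 𝒵 × Fin 2) × ℝ =>
        B.indicator (1 : _ × _ → ℝ≥0∞) (P.train D ω', p) :=
      (measurable_one.indicator hB).comp measurable_prodMk_left
    exact lintegral_const_mul (A.indicator (1 : 𝒳 × ℝ × 𝓛 × 𝒵 × Fin 2 → ℝ≥0∞)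
      (D.sample (Fin.last n) ω)) hBm
  -- Taking the whole space for `A` identifies the second factor as the probability of the event for
  -- `B`.
  have huniv := key Set.univ MeasurableSet.univ
  simp only [Set.preimage_univ, Set.univ_inter, measure_univ, one_mul] at huniv
  rw [key A hA, huniv]

/-- The score of a sample with imputation error, for the training data `t`. -/
noncomputable def Procedure.pairScore (P : Procedure 𝒳 𝓛 𝒵 𝓕 n)
    (t : P.I₁ → 𝒳 × 𝓛 × 𝒵 × Fin 2) (p : (𝒳 × ℝ × 𝓛 × 𝒵 × Fin 2) × ℝ) : ℝ :=
  P.score p.1.1 (if p.1.2.2.2.2 = 0 then p.1.2.1 else P.ghat t p.1.1 p.1.2.2.2.1 + p.2) (P.fit t)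

theorem Procedure.measurable_pairScore (P : Procedure 𝒳 𝓛 𝒵 𝓕 n) :
    Measurable fun q : (P.I₁ → 𝒳 × 𝓛 × 𝒵 × Fin 2) × ((𝒳 × ℝ × 𝓛 × 𝒵 × Fin 2) × ℝ) =>
      P.pairScore q.1 q.2 := by
  refine P.measurable_score.comp (g := fun p : 𝒳 × ℝ × 𝓕 => P.score p.1 p.2.1 p.2.2)
    (f := fun q : (P.I₁ → 𝒳 × 𝓛 × 𝒵 × Fin 2) × ((𝒳 × ℝ × 𝓛 × 𝒵 × Fin 2) × ℝ) =>
      (q.2.1.1, (if q.2.1.2.2.2.2 = 0 then q.2.1.2.1 else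
        P.ghat q.1 q.2.1.1 q.2.1.2.2.2.1 + q.2.2), P.fit q.1)) ?_
  refine Measurable.prodMk (by fun_prop) (Measurable.prodMk ?_
    (P.measurable_fit.comp measurable_fst))
  refine Measurable.ite ?_ (by fun_prop) (Measurable.add ?_ (by fun_prop))
  · exact (show Measurable fun q : (P.I₁ → 𝒳 × 𝓛 × 𝒵 × Fin 2) ×
      ((𝒳 × ℝ × 𝓛 × 𝒵 × Fin 2) × ℝ) => q.2.1.2.2.2.2 by fun_prop) (measurableSet_singleton 0)
  · exact P.measurable_ghat.comp (f := fun q : (P.I₁ → 𝒳 × 𝓛 × 𝒵 × Fin 2) ×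
      ((𝒳 × ℝ × 𝓛 × 𝒵 × Fin 2) × ℝ) => (q.1, q.2.1.1, q.2.1.2.2.2.1)) (by fun_prop)

/-- The threshold as a function of the training data and of the calibration data. -/
noncomputable def Procedure.pairThreshold (P : Procedure 𝒳 𝓛 𝒵 𝓕 n) (α : ℝ)
    (q : (P.I₁ → 𝒳 × 𝓛 × 𝒵 × Fin 2) × (P.I₂ → (𝒳 × ℝ × 𝓛 × 𝒵 × Fin 2) × ℝ)) : EReal :=
  quantile (1 - α) (augmentedEmpirical fun i => P.pairScore q.1 (q.2 i))

theorem Procedure.measurable_pairThreshold (P : Procedure 𝒳 𝓛 𝒵 𝓕 n) (α : ℝ) :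
    Measurable (P.pairThreshold α) :=
  (measurable_quantile_augmentedEmpirical (1 - α)).comp
    (measurable_pi_lambda _ fun i => P.measurable_pairScore.comp
      (f := fun q : (P.I₁ → 𝒳 × 𝓛 × 𝒵 × Fin 2) × (P.I₂ → (𝒳 × ℝ × 𝓛 × 𝒵 × Fin 2) × ℝ) =>
        (q.1, q.2 i)) (by fun_prop))

theorem Procedure.threshold_eq (P : Procedure 𝒳 𝓛 𝒵 𝓕 n) (D : Data Ω 𝒳 𝓛 𝒵 n)
    (e : P.I₂ → Ω → ℝ) (α : ℝ) (ω : Ω) :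
    P.threshold D e α ω = P.pairThreshold α (P.train D ω, P.calibration D e ω) :=
  rfl

theorem Procedure.measurable_threshold (P : Procedure 𝒳 𝓛 𝒵 𝓕 n) (D : Data Ω 𝒳 𝓛 𝒵 n)
    {e : P.I₂ → Ω → ℝ} (he_meas : ∀ i, Measurable (e i)) (α : ℝ) :
    Measurable (P.threshold D e α) := by
  rw [funext (P.threshold_eq D e α)]
  exact (P.measurable_pairThreshold α).comp
    ((P.measurable_train D).prodMk (P.measurable_calibration D he_meas))

/-- The imputed test label is covered with probability at least `1 - α`. -/
theorem Procedure.imputed_coverage [IsProbabilityMeasure μ] (h_indep : iIndepFun D.sample μ)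
    (h_ident : ∀ i, IdentDistrib (D.sample i) (D.sample (Fin.last n)) μ μ)
    (he_meas : ∀ i, Measurable (e i)) (he : P.DrawnFromErrorLaw D e μ)
    {α : ℝ} (hα : 0 ≤ α) :
    ENNReal.ofReal (1 - α) ≤ ∫⁻ ω, P.errorLaw D μ (D.Ztest ω, P.train D ω)
      {y | ((P.pairScore (P.train D ω) (D.sample (Fin.last n) ω, y) : ℝ) : EReal) ≤
        P.threshold D e α ω} ∂μ := by
  have hS := D.measurable_sample (Fin.last n)
  have hprob : IsProbabilityMeasure (μ.map (D.sample (Fin.last n))) :=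
    Measure.isProbabilityMeasure_map hS.aemeasurable
  have hB : MeasurableSet {r : ((P.I₁ → 𝒳 × 𝓛 × 𝒵 × Fin 2) × (𝒳 × ℝ × 𝓛 × 𝒵 × Fin 2) ×
      (P.I₂ → (𝒳 × ℝ × 𝓛 × 𝒵 × Fin 2) × ℝ)) × ℝ |
      ((P.pairScore r.1.1 (r.1.2.1, r.2) : ℝ) : EReal) ≤
        P.pairThreshold α (r.1.1, r.1.2.2)} :=
    measurableSet_le (measurable_coe_real_ereal.comp (P.measurable_pairScore.comp
      (f := fun r : ((P.I₁ → 𝒳 × 𝓛 × 𝒵 × Fin 2) × (𝒳 × ℝ × 𝓛 × 𝒵 × Fin 2) ×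
        (P.I₂ → (𝒳 × ℝ × 𝓛 × 𝒵 × Fin 2) × ℝ)) × ℝ => (r.1.1, (r.1.2.1, r.2))) (by fun_prop)))
      ((P.measurable_pairThreshold α).comp (by fun_prop))
  have hH : Measurable fun q : (P.I₁ → 𝒳 × 𝓛 × 𝒵 × Fin 2) × (𝒳 × ℝ × 𝓛 × 𝒵 × Fin 2) ×
      (P.I₂ → (𝒳 × ℝ × 𝓛 × 𝒵 × Fin 2) × ℝ) => P.sampleErrorLaw D μ q.1 q.2.1
      {y | ((P.pairScore q.1 (q.2.1, y) : ℝ) : EReal) ≤ P.pairThreshold α (q.1, q.2.2)} :=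
    Kernel.measurable_kernel_prodMk_left (κ := (P.errorLaw D μ).comap
      (fun q : (P.I₁ → 𝒳 × 𝓛 × 𝒵 × Fin 2) × (𝒳 × ℝ × 𝓛 × 𝒵 × Fin 2) ×
      (P.I₂ → (𝒳 × ℝ × 𝓛 × 𝒵 × Fin 2) × ℝ) => (q.2.1.2.2.2.1, q.1)) (by fun_prop)) hB
  have h := P.lintegral_joint h_indep h_ident he_meas he hH
  refine le_of_le_of_eq ?_ h.symm
  calc ENNReal.ofReal (1 - α) = ∫⁻ _, ENNReal.ofReal (1 - α) ∂μ := by simp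
    _ ≤ _ := lintegral_mono fun ω' => ?_
  have hsc : Measurable (P.pairScore (P.train D ω')) :=
    P.measurable_pairScore.comp measurable_prodMk_left
  -- For frozen training data the score is a fixed function, and the test sample with its fresh
  -- error has the same law as a calibration pair. The fresh error is no variable on `Ω`; it occurs
  -- only through its kernel.
  refine (conformal_coverage (ι := P.I₂) (μ.map (D.sample (Fin.last n)) ⊗ₘ
    P.sampleErrorLaw D μ (P.train D ω')) hsc (β := 1 - α) (by linarith)).trans (le_of_eq ?_)
  rw [lintegral_lintegral_swap]
  · refine lintegral_congr fun p => ?_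
    rw [Measure.compProd_apply, lintegral_map _ hS]
    · rfl
    · exact Kernel.measurable_kernel_prodMk_left
        (measurableSet_le (measurable_coe_real_ereal.comp hsc) measurable_const)
    · exact measurableSet_le (measurable_coe_real_ereal.comp hsc) measurable_const
  · exact (hH.comp (measurable_const.prodMk ((hS.comp measurable_fst).prodMk
      measurable_snd))).aemeasurable

end JointLaw

/-! ### Coverage of the prediction interval. -/

/-- The indicator of `lo ≤ y ≤ hi`. -/
noncomputable def intervalIndicator : (EReal × EReal) × ℝ → ℝ≥0∞ :=
  {p : (EReal × EReal) × ℝ | p.1.1 ≤ (p.2 : EReal) ∧ (p.2 : EReal) ≤ p.1.2}.indicator 1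

theorem measurable_intervalIndicator : Measurable intervalIndicator := by
  have h : Measurable fun p : (EReal × EReal) × ℝ => (p.2 : EReal) :=
    measurable_coe_real_ereal.comp measurable_snd
  exact measurable_one.indicator
    ((measurableSet_le measurable_fst.fst h).inter (measurableSet_le h measurable_fst.snd))

theorem lintegral_intervalIndicator {Ω : Type*} [MeasurableSpace Ω] (μ : Measure Ω) {g : Ω → ℝ}
    {c : Ω → EReal × EReal} (hg : Measurable g) (hc : Measurable c) :
    ∫⁻ ω, intervalIndicator (c ω, g ω) ∂μ =
      μ {ω | (c ω).1 ≤ (g ω : EReal) ∧ (g ω : EReal) ≤ (c ω).2} := by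
  have h : Measurable fun ω => (g ω : EReal) := measurable_coe_real_ereal.comp hg
  have hm : MeasurableSet {ω | (c ω).1 ≤ (g ω : EReal) ∧ (g ω : EReal) ≤ (c ω).2} :=
    (measurableSet_le hc.fst h).inter (measurableSet_le h hc.snd)
  rw [← lintegral_indicator_one hm]
  rfl

theorem lintegral_shift_add_le_of_peaked {η : Measure ℝ} {A : ℝ} {f : ℝ → ℝ≥0∞} {c : EReal × EReal}
    {ν : Measure ℝ} [IsFiniteMeasure ν]
    (hη : ∀ G : ℝ → ℝ≥0∞, Measurable G → ∫⁻ y, G y ∂ν = ∫⁻ y, G (A + y) ∂η)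
    (hf : ν = volume.withDensity f) (h : PeakedInside f c.1 c.2) (d : ℝ) :
    ∫⁻ y, intervalIndicator (c, A + y + d) ∂η + ∫⁻ y, intervalIndicator (c, A + y - d) ∂η ≤
      2 * ∫⁻ y, intervalIndicator (c, A + y) ∂η := by
  have hJ := measurable_intervalIndicator
  rw [← hη (fun y => intervalIndicator (c, y + d)) (hJ.comp (by fun_prop)),
    ← hη (fun y => intervalIndicator (c, y - d)) (hJ.comp (by fun_prop)),
    ← hη (fun y => intervalIndicator (c, y)) (hJ.comp (by fun_prop)),
    lintegral_intervalIndicator ν (by fun_prop) measurable_const,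
    lintegral_intervalIndicator ν (by fun_prop) measurable_const,
    lintegral_intervalIndicator ν (by fun_prop) measurable_const]
  subst hf
  exact h.measure_shift_add_le d

end UncertainImputation

/-- Validity of uncertain imputation. The endpoints `a`, `b` of the prediction interval are
functions of the fitted model, the threshold and the point `x`, which determine the prediction set.
They are extended reals, so that half-lines and the whole line (infinite threshold) are included;
for an empty prediction set one may take `a = ⊤`, `b = ⊥`. -/
theorem theorem4
    {Ω 𝒳 𝓛 𝒵 𝓕 : Type*} [MeasurableSpace Ω] [StandardBorelSpace Ω]
    [MeasurableSpace 𝒳] [StandardBorelSpace 𝒳] [MeasurableSpace 𝒵] [StandardBorelSpace 𝒵]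
    [MeasurableSpace 𝓛] [MeasurableSpace 𝓕]
    (μ : Measure Ω) [IsProbabilityMeasure μ] (n : ℕ)
    (D : Data Ω 𝒳 𝓛 𝒵 n) (P : Procedure 𝒳 𝓛 𝒵 𝓕 n)
    (α : ℝ) (hα₀ : 0 < α) (hα₁ : α < 1)
    -- the samples are i.i.d.
    (h_indep : iIndepFun D.sample μ)
    (h_ident : ∀ i, IdentDistrib (D.sample i) (D.sample (Fin.last n)) μ μ)
    -- `(X, Y) ⊥ M | Z`
    (h_M : (fun ω => (D.Xtest ω, D.Ytest ω)) ⟂ᵢ[D.Ztest, D.measurable_Ztest; μ] D.Mtest)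
    -- imputation errors drawn from the true law of `E | Z`
    (e : P.I₂ → Ω → ℝ) (he_meas : ∀ i, Measurable (e i))
    (he : P.DrawnFromErrorLaw D e μ)
    -- `C^UI(x) = [a(x), b(x)]`
    (a b : 𝓕 → EReal → 𝒳 → EReal)
    (ha_meas : Measurable (fun p : 𝓕 × EReal × 𝒳 => a p.1 p.2.1 p.2.2))
    (hb_meas : Measurable (fun p : 𝓕 × EReal × 𝒳 => b p.1 p.2.1 p.2.2))
    (h_interval : ∀ᵐ ω ∂μ, P.predictionSet D e α ω (D.Xtest ω) =
      {y : ℝ | a (P.model D ω) (P.threshold D e α ω) (D.Xtest ω) ≤ (y : EReal) ∧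
        (y : EReal) ≤ b (P.model D ω) (P.threshold D e α ω) (D.Xtest ω)})
    -- `Y = g*(X, Z) + ε` with `ε ⊥ X | Z`
    (gstar : 𝒳 → 𝒵 → ℝ) (hg_meas : Measurable (fun p : 𝒳 × 𝒵 => gstar p.1 p.2))
    (ε : Ω → ℝ) (hε_meas : Measurable ε)
    (h_model : ∀ᵐ ω ∂μ, D.Ytest ω = gstar (D.Xtest ω) (D.Ztest ω) + ε ω)
    (hε : ε ⟂ᵢ[D.Ztest, D.measurable_Ztest; μ] D.Xtest)
    -- assumption 1: `ĝ = g* + R` with `R ⊥ (g*, C^UI) | Z`, for the trained models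
    (R : Ω → ℝ) (hR_meas : Measurable R)
    (hR_eq : ∀ᵐ ω ∂μ, P.predictor D ω (D.Xtest ω) (D.Ztest ω) =
      gstar (D.Xtest ω) (D.Ztest ω) + R ω)
    (hR : R ⟂ᵢ[P.testZTrain D, P.measurable_testZTrain D; μ]
      (fun ω => (gstar (D.Xtest ω) (D.Ztest ω),
        a (P.model D ω) (P.threshold D e α ω) (D.Xtest ω),
        b (P.model D ω) (P.threshold D e α ω) (D.Xtest ω))))
    -- assumption 2: the conditional density of `Y | X, Z` is peaked inside `C^UI`
    (f : 𝒳 → 𝒵 → ℝ → ℝ≥0∞)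
    (hf_meas : Measurable (fun p : 𝒳 × 𝒵 × ℝ => f p.1 p.2.1 p.2.2))
    (hf : ∀ᵐ ω ∂μ, condDistrib D.Ytest (fun ω' => (D.Xtest ω', D.Ztest ω')) μ
      (D.Xtest ω, D.Ztest ω) = volume.withDensity (f (D.Xtest ω) (D.Ztest ω)))
    (h_peaked : ∀ᵐ ω ∂μ, PeakedInside (f (D.Xtest ω) (D.Ztest ω))
      (a (P.model D ω) (P.threshold D e α ω) (D.Xtest ω))
      (b (P.model D ω) (P.threshold D e α ω) (D.Xtest ω))) :
    1 - α ≤ μ.real {ω | D.Ytest ω ∈ P.predictionSet D e α ω (D.Xtest ω)} := by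
  have hΩ : Nonempty Ω := nonempty_of_isProbabilityMeasure μ
  have h𝒳 : Nonempty 𝒳 := hΩ.map (D.X 0)
  have hX : Measurable D.Xtest := D.measurable_X _
  have hY : Measurable D.Ytest := D.measurable_Y _
  have hZ : Measurable D.Ztest := D.measurable_Z _
  have hM : Measurable D.Mtest := D.measurable_M _
  have hT := P.measurable_train D
  have hQ := P.measurable_threshold D he_meas α
  let c : (P.I₁ → 𝒳 × 𝓛 × 𝒵 × Fin 2) → EReal → 𝒳 → EReal × EReal := fun t q x =>
    (a (P.fit t) q x, b (P.fit t) q x)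
  have hc : Measurable fun p : (P.I₁ → 𝒳 × 𝓛 × 𝒵 × Fin 2) × EReal × 𝒳 => c p.1 p.2.1 p.2.2 := by
    have hp : Measurable fun p : (P.I₁ → 𝒳 × 𝓛 × 𝒵 × Fin 2) × EReal × 𝒳 => (P.fit p.1, p.2) :=
      (P.measurable_fit.comp measurable_fst).prodMk measurable_snd
    exact (ha_meas.comp hp).prodMk (hb_meas.comp hp)
  have hcω : Measurable fun ω => c (P.train D ω) (P.threshold D e α ω) (D.Xtest ω) :=
    hc.comp (hT.prodMk (hQ.prodMk hX))
  have hgω : Measurable fun ω => gstar (D.Xtest ω) (D.Ztest ω) := hg_meas.comp (hX.prodMk hZ)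
  have hTQ : Measurable fun ω => (P.train D ω, P.threshold D e α ω) := hT.prodMk hQ
  -- The threshold is a function of the training and calibration data, so conditioning identities
  -- for the test sample survive the addition of `(T, Q)`.
  have hind : D.sample (Fin.last n) ⟂ᵢ[μ] fun ω => (P.train D ω, P.threshold D e α ω) := by
    have h := (P.indepFun_test h_indep h_ident he_meas he).comp measurable_id
      (measurable_fst.prodMk (P.measurable_pairThreshold α))
    exact h
  let η : Kernel 𝒵 ℝ := condDistrib ε D.Ztest μ
  let ρ := condDistrib R (P.testZTrain D) μ
  let θ : Kernel 𝒵 (Fin 2) := condDistrib D.Mtest D.Ztest μ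
  have hnoise : ∀ h : 𝒵 × 𝒳 × ℝ → ℝ≥0∞, Measurable h →
      ∫⁻ ω, h (D.Ztest ω, D.Xtest ω, D.Ytest ω - gstar (D.Xtest ω) (D.Ztest ω)) ∂μ =
        ∫⁻ ω, ∫⁻ y, h (D.Ztest ω, D.Xtest ω, y) ∂η (D.Ztest ω) ∂μ := by
    intro h hh
    rw [← lintegral_of_condIndepFun hZ hε_meas hX hε.symm hh]
    refine lintegral_congr_ae ?_
    filter_upwards [h_model] with ω hω
    rw [hω, add_sub_cancel_left]
  have hη : ∀ h : 𝒵 × 𝒳 × ℝ × (P.I₁ → 𝒳 × 𝓛 × 𝒵 × Fin 2) × EReal → ℝ≥0∞, Measurable h →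
      ∫⁻ ω, h (D.Ztest ω, D.Xtest ω, D.Ytest ω - gstar (D.Xtest ω) (D.Ztest ω),
        P.train D ω, P.threshold D e α ω) ∂μ =
      ∫⁻ ω, ∫⁻ y, h (D.Ztest ω, D.Xtest ω, y, P.train D ω, P.threshold D e α ω)
        ∂η (D.Ztest ω) ∂μ := by
    intro h hh
    refine lintegral_disintegration_of_indepFun
      (f := fun ω => D.Ytest ω - gstar (D.Xtest ω) (D.Ztest ω))
      hZ (hY.sub hgω) hX hTQ ?_ η hnoise hh
    refine hind.comp (φ := fun x : 𝒳 × ℝ × 𝓛 × 𝒵 × Fin 2 =>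
      (x.2.2.2.1, x.1, x.2.1 - gstar x.1 x.2.2.2.1)) ?_ measurable_id
    refine Measurable.prodMk (by fun_prop) (Measurable.prodMk (by fun_prop)
      (Measurable.sub (by fun_prop) ?_))
    exact hg_meas.comp (f := fun x : 𝒳 × ℝ × 𝓛 × 𝒵 × Fin 2 => (x.1, x.2.2.2.1)) (by fun_prop)
  have hθ : ∀ h : 𝒵 × (𝒳 × ℝ) × Fin 2 × (P.I₁ → 𝒳 × 𝓛 × 𝒵 × Fin 2) × EReal → ℝ≥0∞,
      Measurable h →
      ∫⁻ ω, h (D.Ztest ω, (D.Xtest ω, D.Ytest ω), D.Mtest ω,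
        P.train D ω, P.threshold D e α ω) ∂μ =
      ∫⁻ ω, ∫⁻ m, h (D.Ztest ω, (D.Xtest ω, D.Ytest ω), m, P.train D ω, P.threshold D e α ω)
        ∂θ (D.Ztest ω) ∂μ := by
    intro h hh
    refine lintegral_disintegration_of_indepFun (g := fun ω => (D.Xtest ω, D.Ytest ω))
      hZ hM (hX.prodMk hY) hTQ ?_ θ
      (fun h hh => lintegral_of_condIndepFun hZ hM (hX.prodMk hY) h_M hh) hh
    exact hind.comp (φ := fun x : 𝒳 × ℝ × 𝓛 × 𝒵 × Fin 2 =>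
      (x.2.2.2.1, (x.1, x.2.1), x.2.2.2.2)) (by fun_prop) measurable_id
  have hρ : ∀ h : (𝒵 × (P.I₁ → 𝒳 × 𝓛 × 𝒵 × Fin 2)) × (ℝ × EReal × EReal) × ℝ → ℝ≥0∞,
      Measurable h →
      ∫⁻ ω, h ((D.Ztest ω, P.train D ω), (gstar (D.Xtest ω) (D.Ztest ω),
        c (P.train D ω) (P.threshold D e α ω) (D.Xtest ω)),
        P.ghat (P.train D ω) (D.Xtest ω) (D.Ztest ω) - gstar (D.Xtest ω) (D.Ztest ω)) ∂μ =
      ∫⁻ ω, ∫⁻ r, h ((D.Ztest ω, P.train D ω), (gstar (D.Xtest ω) (D.Ztest ω),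
        c (P.train D ω) (P.threshold D e α ω) (D.Xtest ω)), r)
          ∂ρ (D.Ztest ω, P.train D ω) ∂μ := by
    intro h hh
    refine Eq.trans ?_ (lintegral_of_condIndepFun (P.measurable_testZTrain D) hR_meas
      (hgω.prodMk hcω) hR.symm hh)
    refine lintegral_congr_ae ?_
    filter_upwards [hR_eq] with ω hω
    have : P.ghat (P.train D ω) (D.Xtest ω) (D.Ztest ω) - gstar (D.Xtest ω) (D.Ztest ω) = R ω :=
      sub_eq_of_eq_add' hω
    rw [this]
    rfl
  have hlabel := condDistrib_label_ae_eq (μ := μ) hX hY hZ hg_meas η hnoise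
  have hpeak : ∀ᵐ ω ∂μ, ∀ d : ℝ,
      ∫⁻ y, intervalIndicator (c (P.train D ω) (P.threshold D e α ω) (D.Xtest ω),
          gstar (D.Xtest ω) (D.Ztest ω) + y + d) ∂η (D.Ztest ω) +
        ∫⁻ y, intervalIndicator (c (P.train D ω) (P.threshold D e α ω) (D.Xtest ω),
          gstar (D.Xtest ω) (D.Ztest ω) + y - d) ∂η (D.Ztest ω) ≤
        2 * ∫⁻ y, intervalIndicator (c (P.train D ω) (P.threshold D e α ω) (D.Xtest ω),
          gstar (D.Xtest ω) (D.Ztest ω) + y) ∂η (D.Ztest ω) := by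
    filter_upwards [hlabel, hf, h_peaked] with ω h1 h2 h3 d
    exact lintegral_shift_add_le_of_peaked h1 h2 h3 d
  have hcomp := lintegral_imputed_le (μ := μ) hX hY hZ hT hg_meas P.measurable_ghat hc η ρ θ
    hη hρ hθ measurable_intervalIndicator hpeak (ψ := fun m => if m = 0 then 0 else 1)
  have hcover := P.imputed_coverage h_indep h_ident he_meas he hα₀.le
  have hJω : Measurable fun ω => intervalIndicator
      (c (P.train D ω) (P.threshold D e α ω) (D.Xtest ω), D.Ytest ω) :=
    measurable_intervalIndicator.comp (hcω.prodMk hY)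
  have hM0 : Measurable fun ω => if D.Mtest ω = 0 then (1 : ℝ≥0∞) else 0 :=
    (measurable_of_finite fun m : Fin 2 => if m = 0 then (1 : ℝ≥0∞) else 0).comp hM
  have hMJ : Measurable fun ω => (if D.Mtest ω = 0 then (1 : ℝ≥0∞) else 0) * intervalIndicator
      (c (P.train D ω) (P.threshold D e α ω) (D.Xtest ω), D.Ytest ω) :=
    hM0.mul hJω
  -- If `M = 0` the imputed score ignores the error, and the error law merely contributes its total
  -- mass `1`; if `M = 1` the integral over the error remains, to be bounded by `hcomp`.
  have hsplit : ∫⁻ ω, P.errorLaw D μ (D.Ztest ω, P.train D ω)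
      {y | ((P.pairScore (P.train D ω) (D.sample (Fin.last n) ω, y) : ℝ) : EReal) ≤
        P.threshold D e α ω} ∂μ =
      ∫⁻ ω, (if D.Mtest ω = 0 then 1 else 0) * intervalIndicator
        (c (P.train D ω) (P.threshold D e α ω) (D.Xtest ω), D.Ytest ω) ∂μ +
      ∫⁻ ω, (if D.Mtest ω = 0 then 0 else 1) * ∫⁻ y, intervalIndicator
        (c (P.train D ω) (P.threshold D e α ω) (D.Xtest ω),
          P.ghat (P.train D ω) (D.Xtest ω) (D.Ztest ω) + y)
        ∂P.errorLaw D μ (D.Ztest ω, P.train D ω) ∂μ := by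
    rw [← lintegral_add_left hMJ]
    refine lintegral_congr_ae ?_
    filter_upwards [h_interval] with ω hω
    have hmem : ∀ y : ℝ, ((P.score (D.Xtest ω) y (P.fit (P.train D ω)) : ℝ) : EReal) ≤
        P.threshold D e α ω ↔
        (c (P.train D ω) (P.threshold D e α ω) (D.Xtest ω)).1 ≤ (y : EReal) ∧
        (y : EReal) ≤ (c (P.train D ω) (P.threshold D e α ω) (D.Xtest ω)).2 :=
      fun y => Set.ext_iff.1 hω y
    by_cases h0 : D.Mtest ω = 0
    · have hs : {y | ((P.pairScore (P.train D ω) (D.sample (Fin.last n) ω, y) : ℝ) : EReal) ≤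
          P.threshold D e α ω} = {_y : ℝ |
          (c (P.train D ω) (P.threshold D e α ω) (D.Xtest ω)).1 ≤ (D.Ytest ω : EReal) ∧
          (D.Ytest ω : EReal) ≤ (c (P.train D ω) (P.threshold D e α ω) (D.Xtest ω)).2} := by
        ext y
        rw [Set.mem_ofPred_eq, Set.mem_ofPred_eq, ← hmem, Procedure.pairScore]
        have h0' : (D.sample (Fin.last n) ω).2.2.2.2 = 0 := h0
        rw [if_pos h0']
        rfl
      rw [hs, if_pos h0, if_pos h0, one_mul, zero_mul, add_zero,
        ← lintegral_intervalIndicator _ measurable_const measurable_const]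
      simp
    · have hs : {y | ((P.pairScore (P.train D ω) (D.sample (Fin.last n) ω, y) : ℝ) : EReal) ≤
          P.threshold D e α ω} = {y : ℝ |
          (c (P.train D ω) (P.threshold D e α ω) (D.Xtest ω)).1 ≤
            ((P.ghat (P.train D ω) (D.Xtest ω) (D.Ztest ω) + y : ℝ) : EReal) ∧
          ((P.ghat (P.train D ω) (D.Xtest ω) (D.Ztest ω) + y : ℝ) : EReal) ≤
            (c (P.train D ω) (P.threshold D e α ω) (D.Xtest ω)).2} := by
        ext y
        rw [Set.mem_ofPred_eq, Set.mem_ofPred_eq, ← hmem, Procedure.pairScore]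
        have h0' : ¬ (D.sample (Fin.last n) ω).2.2.2.2 = 0 := h0
        rw [if_neg h0']
        rfl
      rw [hs, if_neg h0, if_neg h0, one_mul, zero_mul, zero_add,
        ← lintegral_intervalIndicator _ (by fun_prop) measurable_const]
  have hfinal : ENNReal.ofReal (1 - α) ≤
      μ {ω | D.Ytest ω ∈ P.predictionSet D e α ω (D.Xtest ω)} := by
    calc ENNReal.ofReal (1 - α) ≤ _ := hcover
      _ = _ := hsplit
      _ ≤ ∫⁻ ω, (if D.Mtest ω = 0 then 1 else 0) * intervalIndicator
            (c (P.train D ω) (P.threshold D e α ω) (D.Xtest ω), D.Ytest ω) ∂μ +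
          ∫⁻ ω, (if D.Mtest ω = 0 then 0 else 1) * intervalIndicator
            (c (P.train D ω) (P.threshold D e α ω) (D.Xtest ω), D.Ytest ω) ∂μ :=
        add_le_add le_rfl hcomp
      _ = ∫⁻ ω, intervalIndicator
            (c (P.train D ω) (P.threshold D e α ω) (D.Xtest ω), D.Ytest ω) ∂μ := by
        rw [← lintegral_add_left hMJ]
        refine lintegral_congr fun ω => ?_
        by_cases h0 : D.Mtest ω = 0 <;> simp [h0]
      _ = _ := by
        rw [lintegral_intervalIndicator _ hY hcω]
        refine measure_congr ?_
        filter_upwards [h_interval] with ω hω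
        exact propext (Set.ext_iff.1 hω (D.Ytest ω)).symm
  rw [measureReal_def]
  exact (ENNReal.ofReal_le_iff_le_toReal (measure_ne_top _ _)).1 hfinal
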